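/- **Lemma 5.1.** Let $X$ be a locally compact Hausdorff space with countable base, let $\mathcal V$ be a base of the topology of $X$ consisting of relatively compact open sets, and let $(H_V)_{V\in\mathcal V}$ be an elliptic normal Bauer family of harmonic boundary kernels on $X$. Then, for every $x\in X$ and every open neighborhood $V$ of $x$, there exists a strongly stable compact neighborhood $K$ of $x$ with $K\subset V$. Here the following terminology is used. For $U\subset X$ open let $\mathcal V(U):=\{W\in\mathcal V:\overline W\subset U\}$. A *boundary kernel* for $V$ is a (Borel) kernel $H_V$ on $X$ with $H_V(x,X\setminus\partial V)=0$ for $x\in V$ and $H_V(x,\cdot)=\varepsilon_x$ (Dirac measure) for $x\notin V$; we write $H_Vf(x)=\int f(y)\,H_V(x,dy)$. A *local choice* from $\mathcal V$ in $U$ is a map $\mathcal W$ assigning to each $x\in U$ a fundamental system $\mathcal W(x)$ of neighborhoods of $x$ consisting of sets $W\in\mathcal V(U)$ with $x\in W$. A lower semicontinuous function $u\colon U\to\,]-\infty,\infty]$ is *$\mathcal W$-hyperharmonic* on $U$ if $H_Wu(x)\le u(x)$ for all $x\in U$ and $W\in\mathcal W(x)$; it is *hyperharmonic* if this holds with $\mathcal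 W(x)=\{W\in\mathcal V(U):x\in W\}$. A function $h$ is *harmonic* on $U$ if it is continuous and real on $U$ and $H_Wh=h$ for all $W\in\mathcal V(U)$. The family of boundary kernels $(H_V)_{V\in\mathcal V}$ is a *normal Bauer family of harmonic boundary kernels* if, for every $V\in\mathcal V$: 1. $H_WH_V=H_V$ for all $W\in\mathcal V$ with $W\subset V$; 2. $H_V1=1$, and $H_Vf$ is continuous on $X$ for every continuous $f\colon X\to\mathbb R$; 3. there is a local choice $\mathcal W$ from $\mathcal V$ in $V$ such that the $\mathcal W$-hyperharmonic functions $u\ge 0$ on $V$ separate the points of $V$; 4. $H_Vf$ is continuous on $V$ for every bounded Borel function $f$ on $X$. It is *elliptic* if every harmonic function $h\ge0$ on a connected open set $U$ is identically zero or strictly positive on $U$. An open set $W$ is a *$\mathcal P$-set* if the hyperharmonic functions $u\ge0$ on $W$ separate the points of $W$. A compact set $K\neq\emptyset$ is *strongly stable* if it is contained in a $\mathcal P$-set $W$ for which there exists a strictly positive harmonic function $h$ on $W\setminus K$ that tends to zero at $\partial K$, i.e. $\lim_{y\to z,\,y\in W\setminus K}h(y)=0$ for every $z\in\partial K$. -/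

import Mathlib

open Set Filter Topology MeasureTheory ProbabilityTheory

namespace BauerSpace

section Definitions

variable {X : Type*} [TopologicalSpace X] [MeasurableSpace X]

/-- The integral `∫ u dμ = ∫ u⁺ dμ - ∫ u⁻ dμ` of an extended real function. (It is used only for
functions that are bounded below almost everywhere, with respect to probability measures, so that
`∞ - ∞` does not occur.) -/
noncomputable def extIntegral (μ : Measure X) (u : X → EReal) : EReal :=
  ((∫⁻ x, (u x).toENNReal ∂μ : ENNReal) : EReal) -
    ((∫⁻ x, (-(u x)).toENNReal ∂μ : ENNReal) : EReal)

/-- `T` is a boundary kernel for `U`: for `x ∈ U` the measure `T(x, ·)` does not charge the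
complement of `∂U`, and for `x ∉ U` it is the Dirac measure at `x`. -/
def IsBoundaryKernel (U : Set X) (T : Kernel X X) : Prop :=
  (∀ x ∈ U, T x (frontier U)ᶜ = 0) ∧ ∀ x ∉ U, T x = Measure.dirac x

/-- All sets of the base `𝒱` which contain `x` and have their closure in `U`. -/
def nbhdsIn (𝒱 : Set (Set X)) (U : Set X) (x : X) : Set (Set X) :=
  {W | W ∈ 𝒱 ∧ closure W ⊆ U ∧ x ∈ W}

/-- `𝒲` is a local choice from `𝒱` in `U`: for every `x ∈ U`, `𝒲 x` is a fundamental system of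
neighborhoods of `x` consisting of sets of `𝒱` with closure in `U`. -/
def IsLocalChoice (𝒱 : Set (Set X)) (U : Set X) (𝒲 : X → Set (Set X)) : Prop :=
  ∀ x ∈ U, 𝒲 x ⊆ nbhdsIn 𝒱 U x ∧ ∀ N ∈ 𝓝 x, ∃ W ∈ 𝒲 x, W ⊆ N

/-- `u` is `𝒲`-hyperharmonic on `U`. Functions on `U` are given by functions on `X`; only their
values on `U` matter. -/
def IsHyperharmonicFor (H : Set X → Kernel X X) (𝒲 : X → Set (Set X)) (U : Set X)
    (u : X → EReal) : Prop :=
  LowerSemicontinuousOn u U ∧ (∀ x ∈ U, u x ≠ ⊥) ∧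
    ∀ x ∈ U, ∀ W ∈ 𝒲 x, extIntegral (H W x) u ≤ u x

/-- The positive `𝒲`-hyperharmonic functions on `U` separate the points of `U`. -/
def PosHyperharmonicSeparate (H : Set X → Kernel X X) (𝒲 : X → Set (Set X)) (U : Set X) : Prop :=
  ∀ x ∈ U, ∀ y ∈ U, x ≠ y →
    ∃ u : X → EReal, IsHyperharmonicFor H 𝒲 U u ∧ (∀ z ∈ U, 0 ≤ u z) ∧ u x ≠ u y

/-- `h` is harmonic on `U`: continuous and real on `U`, with `H_V h = h` for all `V ∈ 𝒱` with
closure in `U` (outside `V` this equality is trivial). -/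
def IsHarmonicOn (𝒱 : Set (Set X)) (H : Set X → Kernel X X) (U : Set X) (h : X → ℝ) : Prop :=
  ContinuousOn h U ∧ ∀ V ∈ 𝒱, closure V ⊆ U → ∀ x ∈ V, ∫ y, h y ∂(H V x) = h x

/-- `(H_V)`, `V ∈ 𝒱`, is a normal Bauer family of harmonic boundary kernels on `X`, where `𝒱` is a
base of the topology consisting of relatively compact open sets. -/
structure IsNormalBauerFamily (𝒱 : Set (Set X)) (H : Set X → Kernel X X) : Prop where
  isBasis : TopologicalSpace.IsTopologicalBasis 𝒱
  relCompact : ∀ V ∈ 𝒱, IsCompact (closure V)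
  boundary : ∀ V ∈ 𝒱, IsBoundaryKernel V (H V)
  /-- Compatibility `H_W H_V = H_V` for `W ⊆ V`. -/
  compat : ∀ V ∈ 𝒱, ∀ W ∈ 𝒱, W ⊆ V → (H V) ∘ₖ (H W) = H V
  /-- `H_V f` is continuous on `X` for every continuous real `f` on `X`. -/
  continuous : ∀ V ∈ 𝒱, ∀ f : X → ℝ, Continuous f → Continuous fun x => ∫ y, f y ∂(H V x)
  /-- Normality `H_V 1 = 1`. -/
  normal : ∀ V ∈ 𝒱, ∀ x, H V x univ = 1
  /-- Weak separation property. -/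
  separation : ∀ V ∈ 𝒱, ∃ 𝒲, IsLocalChoice 𝒱 V 𝒲 ∧ PosHyperharmonicSeparate H 𝒲 V
  /-- `H_V f` is continuous on `V` for every bounded Borel function `f`. -/
  strongFeller : ∀ V ∈ 𝒱, ∀ f : X → ℝ, Measurable f → (∃ C : ℝ, ∀ x, |f x| ≤ C) →
    ContinuousOn (fun x => ∫ y, f y ∂(H V x)) V

/-- Ellipticity: every positive harmonic function on a connected open set is identically zero or
strictly positive. -/
def IsElliptic (𝒱 : Set (Set X)) (H : Set X → Kernel X X) : Prop :=
  ∀ U : Set X, IsOpen U → IsConnected U → ∀ h : X → ℝ, IsHarmonicOn 𝒱 H U h →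
    (∀ y ∈ U, 0 ≤ h y) → (∀ y ∈ U, h y = 0) ∨ ∀ y ∈ U, 0 < h y

/-- `U` is a `𝒫`-set: an open set whose points are separated by the positive hyperharmonic
functions on `U`. -/
def IsPSet (𝒱 : Set (Set X)) (H : Set X → Kernel X X) (U : Set X) : Prop :=
  IsOpen U ∧ PosHyperharmonicSeparate H (nbhdsIn 𝒱 U) U

/-- `K` is a strongly stable compact: it is non-empty, compact, contained in a `𝒫`-set `W`, and
there is a strictly positive harmonic function on `W \ K` which tends to zero at `∂K`. -/
def IsStronglyStable (𝒱 : Set (Set X)) (H : Set X → Kernel X X) (K : Set X) : Prop :=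
  K.Nonempty ∧ IsCompact K ∧ ∃ W, IsPSet 𝒱 H W ∧ K ⊆ W ∧
    ∃ h : X → ℝ, IsHarmonicOn 𝒱 H (W \ K) h ∧ (∀ y ∈ W \ K, 0 < h y) ∧
      ∀ z ∈ frontier K, Tendsto h (𝓝[W \ K] z) (𝓝 0)

end Definitions

end BauerSpace

/-!
Separation yields a minimum principle: a minimal compact absorbing set has no two separated points,
hence is a single point, which is impossible because `H_W(y, ·)` is carried by `∂W`. It follows that
`𝒲`-hyperharmonic functions are hyperharmonic, so that the sets in `𝒱` are `𝒫`-sets. Applied to the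
indicators of relatively clopen sets it shows that quasi-components are open, by the strong Feller
property, so that `X` is locally connected.

Let `x ∈ W`, `closure W ⊆ V₀`, with `W` and `V₀` in `𝒱`. On a small connected neighbourhood `B` of
`x`, ellipticity rules out that all bounded hyperharmonic functions on `V₀` are harmonic on `B`.
Sweeping one that is not out of `V₀ \ closure B` gives `τ`, and `p = τ - H_W τ` is a nonzero
potential on `W` which is harmonic off `closure B` and tends to zero at `∂W`. By the strong minimum
principle `p ≥ a > 0` near `closure B`. Then `K = {p ≥ a}` is strongly stable, with `h = a - p` on
`W \ K`.
-/

namespace BauerSpace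

section Topology

variable {X : Type*} [TopologicalSpace X] {S U D K : Set X} {x y z : X}

theorem isClosed_of_eventually_notMem (hSU : S ⊆ U)
    (h : ∀ z ∈ closure U, z ∉ S → ∀ᶠ y in 𝓝[U] z, y ∉ S) : IsClosed S := by
  refine isClosed_iff_frequently.2 fun z hz => ?_
  by_contra hzS
  have hzU : z ∈ closure U := closure_mono hSU (mem_closure_iff_frequently.2 hz)
  exact hz ((eventually_nhdsWithin_iff.1 (h z hzU hzS)).mono fun y hy hyS => hy (hSU hyS) hyS)

theorem isClosed_setOf_eq_min {A : Set X} {f : X → ℝ} {m : ℝ} (hA : IsClosed A)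
    (hf : LowerSemicontinuousOn f A) (hm : ∀ y ∈ A, m ≤ f y) :
    IsClosed {y ∈ A | f y = m} := by
  refine isClosed_of_eventually_notMem (sep_subset A _) fun z hz hzm => ?_
  have hzA : z ∈ A := hA.closure_eq ▸ hz
  have hmz : m < f z := (hm z hzA).lt_of_ne fun h => hzm ⟨hzA, h.symm⟩
  exact (hf z hzA m hmz).mono fun y hy hym => hy.ne' hym.2

/-- The quasi-component of `x` in `U`: the intersection of all relatively clopen subsets of the open
set `U` that contain `x`. -/
def quasicomponentIn (U : Set X) (x : X) : Set X :=
  ⋂₀ {A | A ⊆ U ∧ x ∈ A ∧ IsOpen A ∧ IsOpen (U \ A)}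

theorem mem_quasicomponentIn : x ∈ quasicomponentIn U x := fun _ hA => hA.2.1

theorem quasicomponentIn_subset (hU : IsOpen U) (hx : x ∈ U) : quasicomponentIn U x ⊆ U :=
  sInter_subset_of_mem ⟨subset_rfl, hx, hU, by simp⟩

theorem notMem_quasicomponentIn :
    y ∉ quasicomponentIn U x ↔ ∃ A ⊆ U, x ∈ A ∧ IsOpen A ∧ IsOpen (U \ A) ∧ y ∉ A := by
  simp only [quasicomponentIn, mem_sInter, mem_ofPred_eq, not_forall, exists_prop, and_assoc]

theorem isOpen_sdiff_quasicomponentIn : IsOpen (U \ quasicomponentIn U x) := by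
  simp only [quasicomponentIn, sInter_eq_biInter, sdiff_iInter]
  exact isOpen_biUnion fun A hA => hA.2.2.2

theorem isPreconnected_quasicomponentIn (hU : IsOpen U) (hx : x ∈ U)
    (hQ : IsOpen (quasicomponentIn U x)) : IsPreconnected (quasicomponentIn U x) := by
  set Q := quasicomponentIn U x
  have subset_of_mem : ∀ u v, IsOpen u → IsOpen v → Q ⊆ u ∪ v → Q ∩ (u ∩ v) = ∅ → x ∈ u →
      Q ⊆ u := by
    intro u v hu hv huv hdisj hxu
    have hcompl : U \ (Q ∩ u) = (U \ Q) ∪ (Q ∩ v) := by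
      have hQU : Q ⊆ U := quasicomponentIn_subset hU hx
      ext z
      have := @huv z
      have := @hQU z
      have : z ∉ Q ∩ (u ∩ v) := by simp [hdisj]
      grind
    have hclopen : Q ⊆ Q ∩ u := sInter_subset_of_mem
      ⟨inter_subset_left.trans (quasicomponentIn_subset hU hx), ⟨mem_quasicomponentIn, hxu⟩,
        hQ.inter hu, hcompl ▸ isOpen_sdiff_quasicomponentIn.union (hQ.inter hv)⟩
    exact hclopen.trans inter_subset_right
  refine isPreconnected_iff_subset_of_disjoint.2 fun u v hu hv huv hdisj => ?_
  rcases huv (mem_quasicomponentIn : x ∈ Q) with hxu | hxv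
  · exact .inl (subset_of_mem u v hu hv huv hdisj hxu)
  · exact .inr (subset_of_mem v u hv hu (union_comm u v ▸ huv) (inter_comm u v ▸ hdisj) hxv)

theorem closure_connectedComponentIn_inter_subset :
    closure (connectedComponentIn U x) ∩ U ⊆ connectedComponentIn U x := by
  by_cases hx : x ∈ U
  · refine IsPreconnected.subset_connectedComponentIn
      (isPreconnected_connectedComponentIn.subset_closure
        (subset_inter subset_closure (connectedComponentIn_subset U x)) inter_subset_left)
      ⟨subset_closure (mem_connectedComponentIn hx), hx⟩ inter_subset_right
  · simp [connectedComponentIn_eq_empty hx]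

theorem frontier_connectedComponentIn_subset [LocallyConnectedSpace X] (hU : IsOpen U) :
    frontier (connectedComponentIn U x) ⊆ frontier U := by
  rw [hU.connectedComponentIn.frontier_eq, hU.frontier_eq]
  exact fun z hz => ⟨closure_mono (connectedComponentIn_subset U x) hz.1,
    fun hzU => hz.2 (closure_connectedComponentIn_inter_subset ⟨hz.1, hzU⟩)⟩

theorem inter_frontier_nonempty_of_isPreconnected (hS : IsPreconnected S) (hD : IsOpen D)
    (hSD : (S ∩ D).Nonempty) (hnot : ¬ S ⊆ D) : (S ∩ frontier D).Nonempty := by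
  obtain ⟨z, ⟨hzD, hzS⟩, hzD'⟩ : ∃ z ∈ closure D ∩ S, z ∉ D :=
    not_subset.1 fun h => hnot (hS.subset_of_closure_inter_subset hD hSD h)
  exact ⟨z, hzS, hD.frontier_eq ▸ ⟨hzD, hzD'⟩⟩

/-- The points at which the lower limit of `p` is positive. -/
def posLiminfSet (p : X → ℝ) : Set X := {y | ∃ δ > 0, ∀ᶠ z in 𝓝 y, δ ≤ p z}

theorem isOpen_posLiminfSet (p : X → ℝ) : IsOpen (posLiminfSet p) := by
  refine isOpen_iff_mem_nhds.2 fun y ⟨δ, hδ, hy⟩ => ?_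
  filter_upwards [eventually_eventually_nhds.2 hy] with z hz using ⟨δ, hδ, hz⟩

theorem exists_pos_eventually_nhdsSet_le {p : X → ℝ} (hK : IsCompact K)
    (hp : K ⊆ posLiminfSet p) : ∃ δ > 0, ∀ᶠ z in 𝓝ˢ K, δ ≤ p z := by
  refine hK.induction_on ⟨1, one_pos, by simp⟩ ?_ ?_ ?_
  · rintro s t hst ⟨δ, hδ, ht⟩
    exact ⟨δ, hδ, ht.filter_mono (nhdsSet_mono hst)⟩
  · rintro s t ⟨δ, hδ, hs⟩ ⟨ε, hε, ht⟩
    refine ⟨min δ ε, lt_min hδ hε, ?_⟩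
    rw [nhdsSet_union]
    exact eventually_sup.2
      ⟨hs.mono fun _ => min_le_of_left_le, ht.mono fun _ => min_le_of_right_le⟩
  · rintro y hy
    obtain ⟨δ, hδ, hyδ⟩ := hp hy
    exact ⟨{z | ∀ᶠ w in 𝓝 z, δ ≤ p w}, mem_nhdsWithin_of_mem_nhds
      (eventually_eventually_nhds.2 hyδ), δ, hδ, eventually_nhdsSet_iff_forall.2 fun _ hz => hz⟩

theorem lowerSemicontinuous_indicator {g : X → ℝ} (hU : IsOpen U)
    (hg : LowerSemicontinuousOn g U) (h0 : ∀ y ∈ U, 0 ≤ g y) :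
    LowerSemicontinuous (U.indicator g) := by
  intro y t ht
  by_cases hy : y ∈ U
  · rw [indicator_of_mem hy] at ht
    filter_upwards [hU.mem_nhds hy, (hU.nhdsWithin_eq hy ▸ hg y hy t ht)] with z hzU hz
    rwa [indicator_of_mem hzU]
  · rw [indicator_of_notMem hy] at ht
    exact Eventually.of_forall fun z => ht.trans_le (indicator_nonneg h0 z)

end Topology

section Measure

variable {X : Type*} [MeasurableSpace X] {f g : X → ℝ}

/-- Bounded Borel functions. -/
def IsBddBorel (g : X → ℝ) : Prop := Measurable g ∧ ∃ C, ∀ x, |g x| ≤ C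

namespace IsBddBorel

theorem of_mem_Icc {C : ℝ} (hm : Measurable g) (h : ∀ x, g x ∈ Icc 0 C) : IsBddBorel g :=
  ⟨hm, C, fun x => (abs_of_nonneg (h x).1).trans_le (h x).2⟩

theorem const (c : ℝ) : IsBddBorel (fun _ : X => c) := ⟨measurable_const, |c|, fun _ => le_rfl⟩

theorem sub (hf : IsBddBorel f) (hg : IsBddBorel g) : IsBddBorel (fun x => f x - g x) := by
  obtain ⟨hfm, C, hC⟩ := hf
  obtain ⟨hgm, C', hC'⟩ := hg
  exact ⟨hfm.sub hgm, C + C', fun x => (abs_sub _ _).trans (add_le_add (hC x) (hC' x))⟩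

theorem neg (hg : IsBddBorel g) : IsBddBorel (fun x => -g x) :=
  ⟨hg.1.neg, hg.2.imp fun _ hC x => (abs_neg (g x)).trans_le (hC x)⟩

theorem integrable (hg : IsBddBorel g) (μ : Measure X) [IsFiniteMeasure μ] : Integrable g μ :=
  let ⟨hm, C, hC⟩ := hg
  .of_bound hm.aestronglyMeasurable C (.of_forall hC)

theorem integral_kernel (hg : IsBddBorel g) (κ : Kernel X X) [IsMarkovKernel κ] :
    IsBddBorel (fun x => ∫ y, g y ∂(κ x)) := by
  obtain ⟨hm, C, hC⟩ := hg
  refine ⟨(hm.stronglyMeasurable.integral_kernel (κ := κ)).measurable, C, fun x => ?_⟩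
  simpa using norm_integral_le_of_norm_le_const (μ := κ x) (f := g) (.of_forall hC)

end IsBddBorel

theorem indicator_one_mem_Icc {Y : Type*} (B : Set Y) (x : Y) : B.indicator 1 x ∈ Icc (0 : ℝ) 1 :=
  ⟨indicator_nonneg (fun _ _ => zero_le_one) x, indicator_le_self' (fun _ _ => zero_le_one) x⟩

theorem exists_upperSemicontinuous_le_integral_sub_le [TopologicalSpace X]
    [BorelSpace X] {C : ℝ} (hg : Measurable g) (hgC : ∀ x, g x ∈ Icc 0 C)
    (μ : Measure X) [IsFiniteMeasure μ] [μ.WeaklyRegular] {ε : ℝ}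
    (hε : 0 < ε) : ∃ f : X → ℝ, IsBddBorel f ∧ UpperSemicontinuous f ∧ (∀ x, f x ≤ g x) ∧
      ∫ x, g x ∂μ - ε ≤ ∫ x, f x ∂μ := by
  obtain ⟨f, hfg, hf, -, hint⟩ := exists_upperSemicontinuous_le_integral_le (μ := μ)
    (fun x => (⟨g x, (hgC x).1⟩ : NNReal)) ((IsBddBorel.of_mem_Icc hg hgC).integrable μ) hε
  exact ⟨fun x => f x, .of_mem_Icc hf.measurable.coe_nnreal_real
    fun x => ⟨(f x).2, le_trans (hfg x) (hgC x).2⟩,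
    NNReal.continuous_coe.comp_upperSemicontinuous hf NNReal.coe_mono, hfg, hint⟩

variable {μ : Measure X} [IsProbabilityMeasure μ]

theorem integral_mem_Icc {C : ℝ} (hm : Measurable g) (h : ∀ x, g x ∈ Icc 0 C) :
    ∫ y, g y ∂μ ∈ Icc 0 C :=
  ⟨integral_nonneg fun y => (h y).1, by
    simpa using integral_mono ((IsBddBorel.of_mem_Icc hm h).integrable μ) (integrable_const C)
      fun y => (h y).2⟩

theorem ae_eq_of_integral_le (hg : Integrable g μ) {m : ℝ} (hle : ∀ᵐ y ∂μ, m ≤ g y)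
    (hint : ∫ y, g y ∂μ ≤ m) : ∀ᵐ y ∂μ, g y = m := by
  have hmean : ∫ y, g y ∂μ = ∫ _, m ∂μ :=
    le_antisymm (by simpa using hint) (integral_mono_ae (integrable_const m) hg hle)
  filter_upwards [(integral_eq_iff_of_ae_le (integrable_const m) hg hle).1 hmean.symm] with y hy
    using hy.symm

end Measure

section SecondCountable

variable {X : Type*} [TopologicalSpace X] [SecondCountableTopology X] [MeasurableSpace X]
  {μ : Measure X} {𝒜 : Set (Set X)}

theorem ae_mem_sInter_of_isClosed (hcl : ∀ A ∈ 𝒜, IsClosed A) (h𝒜 : ∀ A ∈ 𝒜, ∀ᵐ z ∂μ, z ∈ A) :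
    ∀ᵐ z ∂μ, z ∈ ⋂₀ 𝒜 := by
  refine measure_null_of_locally_null _ fun z hz => ?_
  obtain ⟨A, hA, hzA⟩ : ∃ A ∈ 𝒜, z ∉ A := by simpa [mem_sInter] using hz
  exact ⟨Aᶜ, mem_nhdsWithin_of_mem_nhds ((hcl A hA).isOpen_compl.mem_nhds hzA), h𝒜 A hA⟩

end SecondCountable

namespace IsNormalBauerFamily

variable {X : Type*} [TopologicalSpace X] [MeasurableSpace X] {𝒱 : Set (Set X)}
  {H : Set X → Kernel X X} (hH : IsNormalBauerFamily 𝒱 H) {V W D : Set X} {w x y : X}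
  {f g : X → ℝ}
include hH

theorem isOpen (hV : V ∈ 𝒱) : IsOpen V := hH.isBasis.isOpen hV

theorem notMem_of_mem_frontier (hV : V ∈ 𝒱) (hy : y ∈ frontier V) : y ∉ V :=
  ((hH.isOpen hV).frontier_eq ▸ hy).2

theorem isMarkovKernel (hV : V ∈ 𝒱) : IsMarkovKernel (H V) := ⟨fun x => ⟨hH.normal V hV x⟩⟩

theorem isProbabilityMeasure (hV : V ∈ 𝒱) (x : X) : IsProbabilityMeasure (H V x) :=
  ⟨hH.normal V hV x⟩

theorem ae_mem_frontier (hV : V ∈ 𝒱) (hy : y ∈ V) : ∀ᵐ z ∂(H V y), z ∈ frontier V :=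
  (hH.boundary V hV).1 y hy

theorem frontier_nonempty (hV : V ∈ 𝒱) (hy : y ∈ V) : (frontier V).Nonempty :=
  have := hH.isProbabilityMeasure hV y
  (hH.ae_mem_frontier hV hy).exists

theorem integral_of_notMem (hV : V ∈ 𝒱) (hy : y ∉ V) (hg : Measurable g) :
    ∫ z, g z ∂(H V y) = g y := by
  rw [(hH.boundary V hV).2 y hy, integral_dirac' _ _ hg.stronglyMeasurable]

theorem isBddBorel_integral (hV : V ∈ 𝒱) (hg : IsBddBorel g) :
    IsBddBorel (fun x => ∫ y, g y ∂(H V x)) :=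
  have := hH.isMarkovKernel hV
  hg.integral_kernel (H V)

theorem integrable (hV : V ∈ 𝒱) (hg : IsBddBorel g) (y : X) : Integrable g (H V y) :=
  have := hH.isProbabilityMeasure hV y
  hg.integrable _

theorem integral_integral (hV : V ∈ 𝒱) (hW : W ∈ 𝒱) (hWV : W ⊆ V) (hg : IsBddBorel g) (y : X) :
    ∫ z, ∫ w, g w ∂(H V z) ∂(H W y) = ∫ w, g w ∂(H V y) := by
  have := hH.isMarkovKernel hV
  have := hH.isMarkovKernel hW
  conv_rhs => rw [← hH.compat V hV W hW hWV]
  rw [Kernel.integral_comp (hg.integrable _)]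

theorem integral_mono (hV : V ∈ 𝒱) (hy : y ∈ V) (hf : IsBddBorel f) (hg : IsBddBorel g)
    (h : ∀ z ∈ frontier V, f z ≤ g z) : ∫ z, f z ∂(H V y) ≤ ∫ z, g z ∂(H V y) :=
  integral_mono_ae (hH.integrable hV hf y) (hH.integrable hV hg y)
    ((hH.ae_mem_frontier hV hy).mono h)

theorem integral_const (hV : V ∈ 𝒱) (c : ℝ) (y : X) : ∫ _, c ∂(H V y) = c := by
  have := hH.isProbabilityMeasure hV y
  simp

theorem integral_sub (hV : V ∈ 𝒱) (hf : IsBddBorel f) (hg : IsBddBorel g) (y : X) :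
    ∫ z, (f z - g z) ∂(H V y) = ∫ z, f z ∂(H V y) - ∫ z, g z ∂(H V y) :=
  MeasureTheory.integral_sub (hH.integrable hV hf y) (hH.integrable hV hg y)

theorem continuousOn_integral (hV : V ∈ 𝒱) (hg : IsBddBorel g) :
    ContinuousOn (fun x => ∫ y, g y ∂(H V x)) V :=
  hH.strongFeller V hV g hg.1 hg.2

theorem isHarmonicOn_integral (hV : V ∈ 𝒱) (hg : IsBddBorel g) :
    IsHarmonicOn 𝒱 H V (fun x => ∫ y, g y ∂(H V x)) :=
  ⟨hH.continuousOn_integral hV hg, fun _ hW hWV y _ =>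
    hH.integral_integral hV hW (subset_closure.trans hWV) hg y⟩

theorem exists_closure_subset [RegularSpace X] {N : Set X} (hN : N ∈ 𝓝 y) :
    ∃ W ∈ 𝒱, y ∈ W ∧ closure W ⊆ N := by
  obtain ⟨K, hK, hKc, hKN⟩ := exists_mem_nhds_isClosed_subset hN
  obtain ⟨W, hW, hyW, hWK⟩ := hH.isBasis.mem_nhds_iff.1 hK
  exact ⟨W, hW, hyW, (closure_minimal hWK hKc).trans hKN⟩

variable [T3Space X] [SecondCountableTopology X] [BorelSpace X]

theorem eventually_lt_integral {s t : ℝ} (hD : D ∈ 𝒱) (hw : w ∉ D) (hg : IsBddBorel g)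
    (hs : ∀ᶠ z in 𝓝[frontier D] w, s ≤ g z) (hts : t < s) :
    ∀ᶠ y in 𝓝[D] w, t < ∫ z, g z ∂(H D y) := by
  obtain ⟨C, hC⟩ := hg.2
  obtain ⟨N, hN, hwN, hNs⟩ := mem_nhdsWithin.1 hs
  obtain ⟨f, hf0, hf1, hf⟩ := exists_continuous_zero_one_of_isClosed hN.isClosed_compl
    isClosed_singleton (disjoint_singleton_right.2 (not_not.2 hwN))
  let φ : X → ℝ := fun z => (1 - f z) * -C + f z * s
  have hφc : Continuous φ := by fun_prop
  have hφg : ∀ z ∈ frontier D, φ z ≤ g z := by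
    intro z hz
    have hCz : -C ≤ g z := (abs_le.1 (hC z)).1
    by_cases hzN : z ∈ N
    · have hsz : s ≤ g z := hNs ⟨hzN, hz⟩
      have hf01 := hf z
      nlinarith [mul_le_mul_of_nonneg_left hCz (sub_nonneg.2 hf01.2),
        mul_le_mul_of_nonneg_left hsz hf01.1]
    · simpa [φ, hf0 hzN] using hCz
  have hφb : IsBddBorel φ := by
    refine ⟨hφc.measurable, |C| + |s|, fun z => (abs_add_le _ _).trans (add_le_add ?_ ?_)⟩
    · rw [abs_mul, abs_neg, abs_of_nonneg (sub_nonneg.2 (hf z).2)]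
      exact mul_le_of_le_one_left (abs_nonneg C) (sub_le_self 1 (hf z).1)
    · rw [abs_mul, abs_of_nonneg (hf z).1]
      exact mul_le_of_le_one_left (abs_nonneg s) (hf z).2
  have hφw : ∫ z, φ z ∂(H D w) = s := by
    rw [hH.integral_of_notMem hD hw hφc.measurable]
    simp [φ, hf1 rfl]
  have hlim := (hH.continuous D hD φ hφc).continuousAt (x := w)
  filter_upwards [mem_nhdsWithin_of_mem_nhds (hlim.eventually_const_lt (hφw ▸ hts)),
    self_mem_nhdsWithin] with y hy hyD
  exact hy.trans_le (hH.integral_mono hD hyD hφb hg hφg)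

theorem eventually_integral_lt {s t : ℝ} (hD : D ∈ 𝒱) (hw : w ∉ D) (hg : IsBddBorel g)
    (hs : ∀ᶠ z in 𝓝[frontier D] w, g z ≤ s) (hst : s < t) :
    ∀ᶠ y in 𝓝[D] w, ∫ z, g z ∂(H D y) < t := by
  filter_upwards [hH.eventually_lt_integral hD hw hg.neg (hs.mono fun z => neg_le_neg)
    (neg_lt_neg hst)] with y hy
  rwa [integral_neg, neg_lt_neg_iff] at hy

theorem tendsto_integral (hD : D ∈ 𝒱) (hw : w ∉ D) (hg : IsBddBorel g)
    (hgw : ContinuousWithinAt g (frontier D) w) :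
    Tendsto (fun y => ∫ z, g z ∂(H D y)) (𝓝[D] w) (𝓝 (g w)) := by
  refine tendsto_order.2 ⟨fun t ht => ?_, fun t ht => ?_⟩
  · obtain ⟨s, hts, hs⟩ := exists_between ht
    exact hH.eventually_lt_integral hD hw hg ((hgw.eventually_const_lt hs).mono fun _ => le_of_lt)
      hts
  · obtain ⟨s, hs, hst⟩ := exists_between ht
    exact hH.eventually_integral_lt hD hw hg ((hgw.eventually_lt_const hs).mono fun _ => le_of_lt)
      hst

end IsNormalBauerFamily

section Truncation

/-- The truncation of an extended real number to the interval `[0, c]`. -/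
noncomputable def truncate (c : NNReal) (a : EReal) : ℝ := (min a.toENNReal c).toReal

theorem min_coe_ne_top (a : ENNReal) (c : NNReal) : min a c ≠ ⊤ :=
  ((min_le_right _ _).trans_lt ENNReal.coe_lt_top).ne

theorem truncate_mem_Icc (c : NNReal) (a : EReal) : truncate c a ∈ Icc 0 (c : ℝ) :=
  ⟨ENNReal.toReal_nonneg, ENNReal.toReal_mono ENNReal.coe_ne_top (min_le_right _ _)⟩

theorem monotone_truncate (c : NNReal) : Monotone (truncate c) := fun _ _ hab =>
  ENNReal.toReal_mono (min_coe_ne_top _ c) (min_le_min_right _ (EReal.toENNReal_le_toENNReal hab))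

theorem continuous_truncate (c : NNReal) : Continuous (truncate c) :=
  ENNReal.continuousOn_toReal.comp_continuous
    (EReal.continuous_toENNReal.min continuous_const) fun _ => min_coe_ne_top _ c

theorem exists_truncate_ne {a b : EReal} (ha : 0 ≤ a) (hb : 0 ≤ b) (hab : a ≠ b) :
    ∃ c : NNReal, truncate c a ≠ truncate c b := by
  wlog hlt : a < b generalizing a b
  · obtain ⟨c, hc⟩ := this hb ha hab.symm (hab.lt_or_gt.resolve_left hlt)
    exact ⟨c, hc.symm⟩
  have hlt' : a.toENNReal < b.toENNReal := EReal.toENNReal_lt_toENNReal ha hlt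
  obtain ⟨c, hac, hcb⟩ := ENNReal.lt_iff_exists_nnreal_btwn.1 hlt'
  refine ⟨c, ne_of_lt ?_⟩
  rw [truncate, truncate, min_eq_left hac.le, min_eq_right hcb.le]
  exact ENNReal.toReal_strict_mono ENNReal.coe_ne_top hac

variable {X : Type*} [MeasurableSpace X] {μ : Measure X} {u : X → EReal}

theorem extIntegral_of_nonneg [TopologicalSpace X] (hu : ∀ᵐ z ∂μ, 0 ≤ u z) :
    extIntegral μ u = ((∫⁻ z, (u z).toENNReal ∂μ : ENNReal) : EReal) := by
  have hneg : ∫⁻ z, (-(u z)).toENNReal ∂μ = 0 := by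
    refine (lintegral_congr_ae (hu.mono fun z hz => ?_)).trans lintegral_zero
    exact EReal.toENNReal_of_nonpos (by simpa using hz)
  rw [extIntegral, hneg, EReal.coe_ennreal_zero, sub_zero]

theorem integral_le_truncate [IsProbabilityMeasure μ] {c : NNReal} {g : X → ℝ} {a : EReal}
    (hg : IsBddBorel g) (hgu : ∀ᵐ z ∂μ, g z = truncate c (u z))
    (hua : ∫⁻ z, (u z).toENNReal ∂μ ≤ a.toENNReal) : ∫ z, g z ∂μ ≤ truncate c a := by
  refine (ENNReal.ofReal_le_iff_le_toReal (min_coe_ne_top _ c)).1 ?_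
  have hg0 : 0 ≤ᵐ[μ] g := hgu.mono fun z hz => hz ▸ (truncate_mem_Icc c (u z)).1
  have hg_le : ∀ᵐ z ∂μ, ENNReal.ofReal (g z) ≤ min (u z).toENNReal c := by
    filter_upwards [hgu] with z hz
    rw [hz, truncate, ENNReal.ofReal_toReal (min_coe_ne_top _ c)]
  rw [ofReal_integral_eq_lintegral_ofReal (hg.integrable μ) hg0]
  refine le_min (le_trans ?_ hua)
    (le_trans (lintegral_mono_ae (g := fun _ => (c : ENNReal)) ?_) (by simp))
  · exact lintegral_mono_ae (hg_le.mono fun z hz => hz.trans (min_le_left _ _))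
  · exact hg_le.mono fun z hz => hz.trans (min_le_right _ _)

end Truncation

section BoundedHyperharmonic

variable {X : Type*} [TopologicalSpace X] [MeasurableSpace X]

/-- `g` is a Borel function with values in `[0, C]` which is `𝒲`-hyperharmonic on `U`. Unlike in
`IsHyperharmonicFor`, the values of `g` outside `U` are constrained. -/
structure IsBddHyperharmonicFor (H : Set X → Kernel X X) (𝒲 : X → Set (Set X)) (U : Set X)
    (C : ℝ) (g : X → ℝ) : Prop where
  measurable : Measurable g
  mem_Icc : ∀ x, g x ∈ Icc 0 C
  lsc : LowerSemicontinuousOn g U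
  integral_le : ∀ y ∈ U, ∀ W ∈ 𝒲 y, ∫ z, g z ∂(H W y) ≤ g y

/-- The bounded positive `𝒲`-hyperharmonic functions on `U` separate the points of `U`. -/
def BddHyperharmonicSeparate (H : Set X → Kernel X X) (𝒲 : X → Set (Set X)) (U : Set X) : Prop :=
  ∀ x ∈ U, ∀ y ∈ U, x ≠ y → ∃ C g, IsBddHyperharmonicFor H 𝒲 U C g ∧ g x ≠ g y

/-- `𝒲` is a local choice in `U` for which the bounded positive `𝒲`-hyperharmonic functions on `U`
separate the points of `U`. -/
structure IsSeparatingChoice (𝒱 : Set (Set X)) (H : Set X → Kernel X X) (U : Set X)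
    (𝒲 : X → Set (Set X)) : Prop where
  localChoice : IsLocalChoice 𝒱 U 𝒲
  separate : BddHyperharmonicSeparate H 𝒲 U

variable {𝒱 : Set (Set X)} {H : Set X → Kernel X X} {𝒲 𝒲' : X → Set (Set X)} {U U' : Set X}
  {C : ℝ} {g : X → ℝ}

theorem IsBddHyperharmonicFor.isBddBorel (hg : IsBddHyperharmonicFor H 𝒲 U C g) : IsBddBorel g :=
  .of_mem_Icc hg.measurable hg.mem_Icc

theorem IsBddHyperharmonicFor.mono (hg : IsBddHyperharmonicFor H 𝒲 U C g) (hU : U' ⊆ U)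
    (h𝒲 : ∀ y ∈ U', 𝒲' y ⊆ 𝒲 y) : IsBddHyperharmonicFor H 𝒲' U' C g :=
  ⟨hg.measurable, hg.mem_Icc, hg.lsc.mono hU,
    fun y hy W hW => hg.integral_le y (hU hy) W (h𝒲 y hy hW)⟩

theorem BddHyperharmonicSeparate.mono (h : BddHyperharmonicSeparate H 𝒲 U) (hU : U' ⊆ U)
    (h𝒲 : ∀ y ∈ U', 𝒲' y ⊆ 𝒲 y) : BddHyperharmonicSeparate H 𝒲' U' := by
  intro a ha b hb hab
  obtain ⟨C, g, hg, hne⟩ := h a (hU ha) b (hU hb) hab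
  exact ⟨C, g, hg.mono hU h𝒲, hne⟩

theorem IsSeparatingChoice.refine [RegularSpace X] (h𝒲 : IsSeparatingChoice 𝒱 H U 𝒲)
    (hU : U' ⊆ U) {N : X → Set X} (hN : ∀ y ∈ U', N y ∈ 𝓝 y) (hNU : ∀ y ∈ U', N y ⊆ U') :
    IsSeparatingChoice 𝒱 H U' (fun y => {W ∈ 𝒲 y | closure W ⊆ N y}) := by
  refine ⟨fun y hy => ⟨fun W hW => ?_, fun M hM => ?_⟩,
    h𝒲.separate.mono hU fun _ _ => sep_subset _ _⟩
  · obtain ⟨hW𝒱, -, hyW⟩ := (h𝒲.localChoice y (hU hy)).1 hW.1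
    exact ⟨hW𝒱, hW.2.trans (hNU y hy), hyW⟩
  · obtain ⟨K, hK, hKc, hKMN⟩ := exists_mem_nhds_isClosed_subset (inter_mem hM (hN y hy))
    obtain ⟨W, hW, hWK⟩ := (h𝒲.localChoice y (hU hy)).2 K hK
    exact ⟨W, ⟨hW, (closure_minimal hWK hKc).trans (hKMN.trans inter_subset_right)⟩,
      hWK.trans (hKMN.trans inter_subset_left)⟩

namespace IsNormalBauerFamily

variable [BorelSpace X] (hH : IsNormalBauerFamily 𝒱 H)
include hH

theorem isBddHyperharmonicFor_truncate {u : X → EReal} (c : NNReal) (hU : IsOpen U)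
    (h𝒲 : ∀ y ∈ U, 𝒲 y ⊆ nbhdsIn 𝒱 U y) (hu : IsHyperharmonicFor H 𝒲 U u)
    (hu0 : ∀ z ∈ U, 0 ≤ u z) :
    IsBddHyperharmonicFor H 𝒲 U c (U.indicator fun z => truncate c (u z)) := by
  set g := U.indicator fun z => truncate c (u z)
  have hgU : ∀ z ∈ U, g z = truncate c (u z) := fun z hz => indicator_of_mem hz _
  have hlsc : LowerSemicontinuous g := lowerSemicontinuous_indicator hU
    ((continuous_truncate c).comp_lowerSemicontinuousOn hu.1 (monotone_truncate c))
    fun z _ => (truncate_mem_Icc c (u z)).1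
  have hmem : ∀ z, g z ∈ Icc 0 (c : ℝ) := fun z => by
    by_cases hz : z ∈ U
    · exact hgU z hz ▸ truncate_mem_Icc c (u z)
    · rw [show g z = 0 from indicator_of_notMem hz _]
      exact ⟨le_rfl, c.2⟩
  refine ⟨hlsc.measurable, hmem, hlsc.lowerSemicontinuousOn U, fun y hy W hW => ?_⟩
  obtain ⟨hW𝒱, hWU, hyW⟩ := h𝒲 y hy hW
  have := hH.isProbabilityMeasure hW𝒱 y
  have hae : ∀ᵐ z ∂(H W y), z ∈ U :=
    (hH.ae_mem_frontier hW𝒱 hyW).mono fun z hz => hWU (frontier_subset_closure hz)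
  have hle := hu.2.2 y hy W hW
  rw [extIntegral_of_nonneg (hae.mono hu0)] at hle
  rw [hgU y hy]
  exact integral_le_truncate (.of_mem_Icc hlsc.measurable hmem) (hae.mono hgU)
    (by simpa using EReal.toENNReal_le_toENNReal hle)

theorem exists_isSeparatingChoice {V : Set X} (hV : V ∈ 𝒱) :
    ∃ 𝒲, IsSeparatingChoice 𝒱 H V 𝒲 := by
  obtain ⟨𝒲, h𝒲, hsep⟩ := hH.separation V hV
  refine ⟨𝒲, h𝒲, fun a ha b hb hab => ?_⟩
  obtain ⟨u, hu, hu0, hne⟩ := hsep a ha b hb hab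
  obtain ⟨c, hc⟩ := exists_truncate_ne (hu0 a ha) (hu0 b hb) hne
  refine ⟨c, _, hH.isBddHyperharmonicFor_truncate c (hH.isOpen hV)
    (fun y hy => (h𝒲 y hy).1) hu hu0, ?_⟩
  rwa [indicator_of_mem ha, indicator_of_mem hb]

end IsNormalBauerFamily

end BoundedHyperharmonic

section MinimumPrinciple

variable {X : Type*} [TopologicalSpace X] [MeasurableSpace X] {𝒱 : Set (Set X)}
  {H : Set X → Kernel X X} {𝒲 : X → Set (Set X)} {U A K : Set X} {m : ℝ} {f g : X → ℝ}

/-- `A` is absorbing for the local choice `𝒲`: the measures `H_W(y, ·)`, `W ∈ 𝒲 y`, of its points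
`y` are carried by `A`. -/
def IsAbsorbing (H : Set X → Kernel X X) (𝒲 : X → Set (Set X)) (A : Set X) : Prop :=
  ∀ y ∈ A, ∀ W ∈ 𝒲 y, ∀ᵐ z ∂(H W y), z ∈ A

theorem isAbsorbing_sInter [SecondCountableTopology X] {𝒜 : Set (Set X)}
    (hcl : ∀ A ∈ 𝒜, IsClosed A) (habs : ∀ A ∈ 𝒜, IsAbsorbing H 𝒲 A) : IsAbsorbing H 𝒲 (⋂₀ 𝒜) :=
  fun y hy W hW => ae_mem_sInter_of_isClosed hcl fun A hA => habs A hA y (hy A hA) W hW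

theorem exists_minimal_isAbsorbing [T2Space X] [SecondCountableTopology X] (hK : IsCompact K)
    (hne : K.Nonempty) (habs : IsAbsorbing H 𝒲 K) :
    ∃ A ⊆ K, Minimal (fun A => IsClosed A ∧ A.Nonempty ∧ IsAbsorbing H 𝒲 A) A := by
  have exists_lb : ∀ 𝒜 ⊆ {A | A ⊆ K ∧ IsClosed A ∧ A.Nonempty ∧ IsAbsorbing H 𝒲 A},
      IsChain (· ⊆ ·) 𝒜 → 𝒜.Nonempty →
      ∃ B ∈ {A | A ⊆ K ∧ IsClosed A ∧ A.Nonempty ∧ IsAbsorbing H 𝒲 A}, ∀ A ∈ 𝒜, B ⊆ A := by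
    intro 𝒜 h𝒜 hchain ⟨A₀, hA₀⟩
    have : Nonempty 𝒜 := ⟨A₀, hA₀⟩
    have hdir : DirectedOn (· ⊇ ·) 𝒜 := IsChain.directedOn hchain.symm
    have hne : (⋂₀ 𝒜).Nonempty :=
      IsCompact.nonempty_sInter_of_directed_nonempty_isCompact_isClosed hdir
        (fun A hA => (h𝒜 hA).2.2.1)
        (fun A hA => hK.of_isClosed_subset (h𝒜 hA).2.1 (h𝒜 hA).1) fun A hA => (h𝒜 hA).2.1
    exact ⟨⋂₀ 𝒜, ⟨(sInter_subset_of_mem hA₀).trans (h𝒜 hA₀).1,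
      isClosed_sInter fun A hA => (h𝒜 hA).2.1, hne,
      isAbsorbing_sInter (fun A hA => (h𝒜 hA).2.1) fun A hA => (h𝒜 hA).2.2.2⟩,
      fun A hA => sInter_subset_of_mem hA⟩
  obtain ⟨A, hAK, hA⟩ := zorn_superset_nonempty _ exists_lb K ⟨subset_rfl, hK.isClosed, hne, habs⟩
  exact ⟨A, hAK, hA.prop.2, fun B hB hBA => hA.le_of_le ⟨hBA.trans hAK, hB⟩ hBA⟩

namespace IsNormalBauerFamily

variable (hH : IsNormalBauerFamily 𝒱 H)
include hH

theorem isAbsorbing_of_isLocalChoice (h𝒲 : IsLocalChoice 𝒱 U 𝒲) : IsAbsorbing H 𝒲 U :=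
  fun y hy _ hW =>
    let ⟨hW𝒱, hWU, hyW⟩ := (h𝒲 y hy).1 hW
    (hH.ae_mem_frontier hW𝒱 hyW).mono fun _ hz => hWU (frontier_subset_closure hz)

theorem isAbsorbing_setOf_eq_min (h𝒲 : ∀ y ∈ A, 𝒲 y ⊆ 𝒱) (hA : IsAbsorbing H 𝒲 A)
    (hf : IsBddBorel f) (hfA : ∀ y ∈ A, ∀ W ∈ 𝒲 y, ∫ z, f z ∂(H W y) ≤ f y)
    (hm : ∀ y ∈ A, m ≤ f y) : IsAbsorbing H 𝒲 {y ∈ A | f y = m} := by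
  rintro y ⟨hyA, rfl⟩ W hW
  have := hH.isProbabilityMeasure (h𝒲 y hyA hW) y
  have hae := hA y hyA W hW
  exact hae.and (ae_eq_of_integral_le (hf.integrable _) (hae.mono hm) (hfA y hyA W hW))

theorem not_isAbsorbing_singleton [T1Space X] (h𝒲 : IsLocalChoice 𝒱 U 𝒲) {y : X} (hy : y ∈ U) :
    ¬ IsAbsorbing H 𝒲 {y} := by
  intro habs
  obtain ⟨W, hW, -⟩ := (h𝒲 y hy).2 univ univ_mem
  obtain ⟨hW𝒱, -, hyW⟩ := (h𝒲 y hy).1 hW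
  have := hH.isProbabilityMeasure hW𝒱 y
  obtain ⟨z, rfl, hz⟩ := ((habs y rfl W hW).and (hH.ae_mem_frontier hW𝒱 hyW)).exists
  exact hH.notMem_of_mem_frontier hW𝒱 hz hyW

/-- The minimum set of a function separating two points of `A` would be a smaller absorbing set. -/
theorem subsingleton_of_minimal_isAbsorbing (h𝒲 : IsSeparatingChoice 𝒱 H U 𝒲) (hAU : A ⊆ U)
    (hAc : IsCompact A)
    (hA : Minimal (fun A => IsClosed A ∧ A.Nonempty ∧ IsAbsorbing H 𝒲 A) A) :
    A.Subsingleton := by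
  intro a ha b hb
  by_contra hab
  obtain ⟨C, g, hg, hne⟩ := h𝒲.separate a (hAU ha) b (hAU hb) hab
  obtain ⟨y₀, hy₀, hmin⟩ := (hg.lsc.mono hAU).exists_isMinOn hA.prop.2.1 hAc
  have hclosed : IsClosed {y ∈ A | g y = g y₀} :=
    isClosed_setOf_eq_min hA.prop.1 (hg.lsc.mono hAU) hmin
  have habs : IsAbsorbing H 𝒲 {y ∈ A | g y = g y₀} :=
    hH.isAbsorbing_setOf_eq_min (fun y hy W hW => ((h𝒲.localChoice y (hAU hy)).1 hW).1)
      hA.prop.2.2 hg.isBddBorel (fun y hy => hg.integral_le y (hAU hy)) hmin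
  have hsub := hA.le_of_le ⟨hclosed, ⟨y₀, hy₀, rfl⟩, habs⟩ (sep_subset A _)
  exact hne ((hsub ha).2.trans (hsub hb).2.symm)

variable [T2Space X] [SecondCountableTopology X]

theorem not_isAbsorbing_of_isCompact (h𝒲 : IsSeparatingChoice 𝒱 H U 𝒲) (hKU : K ⊆ U)
    (hK : IsCompact K) (hne : K.Nonempty) : ¬ IsAbsorbing H 𝒲 K := by
  intro habs
  obtain ⟨A, hAK, hA⟩ := exists_minimal_isAbsorbing hK hne habs
  obtain ⟨y, hy⟩ := hA.prop.2.1
  have hAy : A = {y} := (hH.subsingleton_of_minimal_isAbsorbing h𝒲 (hAK.trans hKU)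
    (hK.of_isClosed_subset hA.prop.1 hAK) hA).eq_singleton_of_mem hy
  exact hH.not_isAbsorbing_singleton h𝒲.localChoice (hKU (hAK hy)) (hAy ▸ hA.prop.2.2)

theorem minimum_principle (h𝒲 : IsSeparatingChoice 𝒱 H U 𝒲) (hU : IsOpen U)
    (hUc : IsCompact (closure U)) (hg : IsBddBorel g) (hlsc : LowerSemicontinuousOn g U)
    (hgU : ∀ y ∈ U, ∀ W ∈ 𝒲 y, ∫ z, g z ∂(H W y) ≤ g y)
    (hfr : ∀ z ∈ frontier U, ∀ ε > 0, ∀ᶠ y in 𝓝[U] z, -ε < g y) : ∀ y ∈ U, 0 ≤ g y := by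
  have isCompact_sublevel : ∀ t < 0, IsCompact {y ∈ U | g y ≤ t} := by
    intro t ht
    refine hUc.of_isClosed_subset (isClosed_of_eventually_notMem (sep_subset U _)
      fun z hz hzt => ?_) ((sep_subset U _).trans subset_closure)
    have hev : ∀ᶠ y in 𝓝[U] z, t < g y := by
      by_cases hzU : z ∈ U
      · exact hlsc z hzU t (not_le.1 fun h => hzt ⟨hzU, h⟩)
      · simpa using hfr z (hU.frontier_eq ▸ ⟨hz, hzU⟩) (-t) (neg_pos.2 ht)
    exact hev.mono fun y hy hyt => hy.not_ge hyt.2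
  by_contra! hneg
  obtain ⟨x, hxU, hx⟩ := hneg
  have hne : {y ∈ U | g y ≤ g x}.Nonempty := ⟨x, hxU, le_rfl⟩
  obtain ⟨y₀, ⟨hy₀U, hy₀⟩, hmin⟩ :=
    (hlsc.mono (sep_subset U _)).exists_isMinOn hne (isCompact_sublevel (g x) hx)
  have hminU : ∀ y ∈ U, g y₀ ≤ g y := fun y hy => by
    by_cases hyx : g y ≤ g x
    · exact hmin ⟨hy, hyx⟩
    · exact hy₀.trans (not_le.1 hyx).le
  have hcompact : IsCompact {y ∈ U | g y = g y₀} := by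
    convert isCompact_sublevel (g y₀) (hy₀.trans_lt hx) using 3 with y
    exact and_congr_right fun hy => ⟨le_of_eq, fun h => h.antisymm (hminU y hy)⟩
  exact hH.not_isAbsorbing_of_isCompact h𝒲 (sep_subset U _) hcompact ⟨y₀, hy₀U, rfl⟩
    (hH.isAbsorbing_setOf_eq_min (fun y hy W hW => ((h𝒲.localChoice y hy).1 hW).1)
      (hH.isAbsorbing_of_isLocalChoice h𝒲.localChoice) hg hgU hminU)

end IsNormalBauerFamily

end MinimumPrinciple

section Hyperharmonic

variable {X : Type*} [TopologicalSpace X] [T3Space X] [SecondCountableTopology X]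
  [MeasurableSpace X] [BorelSpace X] {𝒱 : Set (Set X)} {H : Set X → Kernel X X}
  {𝒲 : X → Set (Set X)} {U D : Set X} {C : ℝ} {g : X → ℝ}

namespace IsNormalBauerFamily

variable (hH : IsNormalBauerFamily 𝒱 H)
include hH

theorem integral_le_of_isSeparatingChoice (h𝒲 : IsSeparatingChoice 𝒱 H U 𝒲)
    (hg : IsBddHyperharmonicFor H 𝒲 U C g) (hD : D ∈ 𝒱) (hDU : closure D ⊆ U) {y : X}
    (hy : y ∈ D) : ∫ z, g z ∂(H D y) ≤ g y := by
  have := hH.isProbabilityMeasure hD y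
  have hDU' : D ⊆ U := subset_closure.trans hDU
  have hDo := hH.isOpen hD
  refine le_of_forall_pos_le_add fun ε hε => ?_
  obtain ⟨f, hf, hfusc, hfg, hfint⟩ :=
    exists_upperSemicontinuous_le_integral_sub_le hg.measurable hg.mem_Icc (H D y) hε
  have h𝒲D : IsSeparatingChoice 𝒱 H D fun y => {W ∈ 𝒲 y | closure W ⊆ D} :=
    h𝒲.refine hDU' (fun y hy => hDo.mem_nhds hy) fun _ _ => subset_rfl
  have hf' := hH.isBddBorel_integral hD hf
  have hmin := hH.minimum_principle h𝒲D hDo (hH.relCompact D hD) (hg.isBddBorel.sub hf') ?_ ?_ ?_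
    y hy
  · linarith
  · exact (hg.lsc.mono hDU').add (hH.continuousOn_integral hD hf).neg.lowerSemicontinuousOn
  · rintro z hz W ⟨hW, hWD⟩
    have hW𝒱 := ((h𝒲.localChoice z (hDU' hz)).1 hW).1
    rw [hH.integral_sub hW𝒱 hg.isBddBorel hf',
      hH.integral_integral hD hW𝒱 (subset_closure.trans hWD) hf]
    exact sub_le_sub_right (hg.integral_le z (hDU' hz) W hW) _
  · intro w hw ε hε
    have hgw : ∀ᶠ z in 𝓝[D] w, g w - ε / 2 < g z :=
      (hg.lsc w (hDU (frontier_subset_closure hw)) _ (by linarith)).filter_mono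
        (nhdsWithin_mono w hDU')
    have hfw : ∀ᶠ z in 𝓝[D] w, ∫ v, f v ∂(H D z) < g w + ε / 2 :=
      hH.eventually_integral_lt hD (hH.notMem_of_mem_frontier hD hw) hf
        (((hfusc w (g w + ε / 3) (by linarith [hfg w])).filter_mono nhdsWithin_le_nhds).mono
          fun _ => le_of_lt) (by linarith)
    filter_upwards [hgw, hfw] with z hgz hfz
    linarith

end IsNormalBauerFamily

end Hyperharmonic

section PSets

variable {X : Type*} [TopologicalSpace X] [MeasurableSpace X] {𝒱 : Set (Set X)}
  {H : Set X → Kernel X X} {U V : Set X} {C : ℝ} {g : X → ℝ}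

theorem IsBddHyperharmonicFor.isHyperharmonicFor {𝒲 : X → Set (Set X)}
    (hH : IsNormalBauerFamily 𝒱 H) (hg : IsBddHyperharmonicFor H 𝒲 U C g)
    (h𝒲 : ∀ y ∈ U, 𝒲 y ⊆ 𝒱) : IsHyperharmonicFor H 𝒲 U fun y => (g y : EReal) := by
  refine ⟨continuous_coe_real_ereal.comp_lowerSemicontinuousOn hg.lsc EReal.coe_strictMono.monotone,
    fun y _ => EReal.coe_ne_bot _, fun y hy W hW => ?_⟩
  have := hH.isProbabilityMeasure (h𝒲 y hy hW) y
  have hg0 : ∀ z, 0 ≤ g z := fun z => (hg.mem_Icc z).1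
  have hint : ∫⁻ z, (g z : EReal).toENNReal ∂(H W y) = ENNReal.ofReal (∫ z, g z ∂(H W y)) := by
    simp only [EReal.toENNReal_of_ne_top (EReal.coe_ne_top _), EReal.toReal_coe]
    exact (ofReal_integral_eq_lintegral_ofReal (hg.isBddBorel.integrable _) (.of_forall hg0)).symm
  rw [extIntegral_of_nonneg (.of_forall fun z => EReal.coe_nonneg.2 (hg0 z)), hint,
    EReal.coe_ennreal_ofReal, max_eq_left (integral_nonneg hg0), EReal.coe_le_coe_iff]
  exact hg.integral_le y hy W hW

namespace IsNormalBauerFamily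

variable [T3Space X] [SecondCountableTopology X] [BorelSpace X] (hH : IsNormalBauerFamily 𝒱 H)
include hH

omit [SecondCountableTopology X] [BorelSpace X] in
theorem isLocalChoice_nbhdsIn (hU : IsOpen U) : IsLocalChoice 𝒱 U (nbhdsIn 𝒱 U) := by
  refine fun y hy => ⟨subset_rfl, fun N hN => ?_⟩
  obtain ⟨W, hW, hyW, hWN⟩ := hH.exists_closure_subset (inter_mem hN (hU.mem_nhds hy))
  exact ⟨W, ⟨hW, hWN.trans inter_subset_right, hyW⟩,
    subset_closure.trans (hWN.trans inter_subset_left)⟩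

theorem isBddHyperharmonicFor_nbhdsIn {𝒲 : X → Set (Set X)} (h𝒲 : IsSeparatingChoice 𝒱 H U 𝒲)
    (hg : IsBddHyperharmonicFor H 𝒲 U C g) : IsBddHyperharmonicFor H (nbhdsIn 𝒱 U) U C g :=
  ⟨hg.measurable, hg.mem_Icc, hg.lsc, fun _ _ _ hD =>
    hH.integral_le_of_isSeparatingChoice h𝒲 hg hD.1 hD.2.1 hD.2.2⟩

theorem isSeparatingChoice_nbhdsIn (hV : V ∈ 𝒱) :
    IsSeparatingChoice 𝒱 H V (nbhdsIn 𝒱 V) := by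
  obtain ⟨𝒲, h𝒲⟩ := hH.exists_isSeparatingChoice hV
  refine ⟨hH.isLocalChoice_nbhdsIn (hH.isOpen hV), fun a ha b hb hab => ?_⟩
  obtain ⟨C, g, hg, hne⟩ := h𝒲.separate a ha b hb hab
  exact ⟨C, g, hH.isBddHyperharmonicFor_nbhdsIn h𝒲 hg, hne⟩

theorem isPSet (hV : V ∈ 𝒱) : IsPSet 𝒱 H V := by
  refine ⟨hH.isOpen hV, fun a ha b hb hab => ?_⟩
  obtain ⟨C, g, hg, hne⟩ := (hH.isSeparatingChoice_nbhdsIn hV).separate a ha b hb hab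
  exact ⟨_, hg.isHyperharmonicFor hH fun y _ D hD => hD.1,
    fun z _ => EReal.coe_nonneg.2 (hg.mem_Icc z).1, fun h => hne (EReal.coe_injective h)⟩

end IsNormalBauerFamily

end PSets

section LocallyConnected

variable {X : Type*} [TopologicalSpace X] [T3Space X] [SecondCountableTopology X]
  [MeasurableSpace X] [BorelSpace X] {𝒱 : Set (Set X)}
  {H : Set X → Kernel X X} {V D B : Set X} {x y : X}

namespace IsNormalBauerFamily

variable (hH : IsNormalBauerFamily 𝒱 H)
include hH

theorem ae_notMem_of_isOpen_sdiff (hV : V ∈ 𝒱) (hB : IsOpen B) (hBV : B ⊆ V)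
    (hVB : IsOpen (V \ B)) (hD : D ∈ 𝒱) (hDV : closure D ⊆ V) (hy : y ∈ D) (hyB : y ∉ B) :
    ∀ᵐ z ∂(H D y), z ∉ B := by
  classical
  let N : X → Set X := fun y => if y ∈ B then B else V \ B
  have hN : ∀ y ∈ V, N y ∈ 𝓝 y := fun y hy => by
    by_cases hyB : y ∈ B
    · simpa only [N, if_pos hyB] using hB.mem_nhds hyB
    · simpa only [N, if_neg hyB] using hVB.mem_nhds ⟨hy, hyB⟩
  have hNV : ∀ y ∈ V, N y ⊆ V := fun y _ => by
    simp only [N]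
    split_ifs
    exacts [hBV, sdiff_subset]
  -- Since `B` and `V \ B` are open, it suffices to test hyperharmonicity of the indicator of `B`
  -- with sets lying on one side.
  have h𝒲 := (hH.isSeparatingChoice_nbhdsIn hV).refine subset_rfl hN hNV
  have hBm : Measurable (B.indicator (1 : X → ℝ)) := measurable_one.indicator hB.measurableSet
  have hg : IsBddHyperharmonicFor H (fun y => {W ∈ nbhdsIn 𝒱 V y | closure W ⊆ N y}) V 1
      (B.indicator 1) := by
    refine ⟨hBm, indicator_one_mem_Icc B, hB.lowerSemicontinuousOn_indicator zero_le_one, ?_⟩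
    rintro y - W ⟨⟨hW, -, hyW⟩, hWN⟩
    have := hH.isProbabilityMeasure hW y
    by_cases hyB : y ∈ B
    · rw [indicator_of_mem hyB]
      exact (integral_mem_Icc hBm (indicator_one_mem_Icc B)).2
    · rw [indicator_of_notMem hyB]
      simp only [N, if_neg hyB] at hWN
      refine (integral_eq_zero_of_ae ((hH.ae_mem_frontier hW hyW).mono fun z hz => ?_)).le
      exact indicator_of_notMem (hWN (frontier_subset_closure hz)).2 _
  have hle := hH.integral_le_of_isSeparatingChoice h𝒲 hg hD hDV hy
  have := hH.isProbabilityMeasure hD y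
  rw [indicator_of_notMem hyB, integral_indicator_one hB.measurableSet] at hle
  exact measure_eq_zero_iff_ae_notMem.1
    ((measureReal_eq_zero_iff (measure_ne_top _ _)).1 (hle.antisymm measureReal_nonneg))

theorem ae_mem_quasicomponentIn (hV : V ∈ 𝒱) (hD : D ∈ 𝒱) (hDV : closure D ⊆ V) (hy : y ∈ D)
    (hyQ : y ∈ quasicomponentIn V x) : ∀ᵐ z ∂(H D y), z ∈ quasicomponentIn V x := by
  have hnull : H D y (V \ quasicomponentIn V x) = 0 := by
    refine measure_null_of_locally_null _ fun z hz => ?_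
    obtain ⟨A, hAV, hxA, hA, hVA, hzA⟩ := notMem_quasicomponentIn.1 hz.2
    have hyA : y ∈ A := hyQ A ⟨hAV, hxA, hA, hVA⟩
    exact ⟨V \ A, mem_nhdsWithin_of_mem_nhds (hVA.mem_nhds ⟨hz.1, hzA⟩),
      measure_eq_zero_iff_ae_notMem.2 (hH.ae_notMem_of_isOpen_sdiff hV hVA sdiff_subset
        ((sdiff_sdiff_cancel_left hAV).symm ▸ hA) hD hDV hy fun h => h.2 hyA)⟩
  filter_upwards [hH.ae_mem_frontier hD hy, measure_eq_zero_iff_ae_notMem.1 hnull] with z hz hzQ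
  by_contra h
  exact hzQ ⟨hDV (frontier_subset_closure hz), h⟩

theorem ae_notMem_quasicomponentIn (hV : V ∈ 𝒱) (hD : D ∈ 𝒱) (hDV : closure D ⊆ V) (hy : y ∈ D)
    (hyQ : y ∉ quasicomponentIn V x) : ∀ᵐ z ∂(H D y), z ∉ quasicomponentIn V x := by
  obtain ⟨A, hAV, hxA, hA, hVA, hyA⟩ := notMem_quasicomponentIn.1 hyQ
  exact (hH.ae_notMem_of_isOpen_sdiff hV hA hAV hVA hD hDV hy hyA).mono
    fun z hzA hzQ => hzA (hzQ A ⟨hAV, hxA, hA, hVA⟩)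

/-- The function `y ↦ H_D(y, Q)` is the indicator of the quasi-component `Q` on `D`, and it is
continuous on `D` by the strong Feller property. -/
theorem isOpen_quasicomponentIn (hV : V ∈ 𝒱) (hx : x ∈ V) : IsOpen (quasicomponentIn V x) := by
  set Q := quasicomponentIn V x
  have hQV : Q ⊆ V := quasicomponentIn_subset (hH.isOpen hV) hx
  have hQm : MeasurableSet Q := by
    rw [← sdiff_sdiff_cancel_left hQV]
    exact (hH.isOpen hV).measurableSet.diff isOpen_sdiff_quasicomponentIn.measurableSet
  refine isOpen_iff_mem_nhds.2 fun y hy => ?_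
  obtain ⟨D, hD, hyD, hDV⟩ := hH.exists_closure_subset ((hH.isOpen hV).mem_nhds (hQV hy))
  have hcont : ContinuousOn (fun z => (H D z).real Q) D := by
    simpa only [integral_indicator_one hQm] using hH.continuousOn_integral hD
      (.of_mem_Icc (measurable_one.indicator hQm) (indicator_one_mem_Icc Q))
  have hy1 : (H D y).real Q ≠ 0 := by
    have := hH.isProbabilityMeasure hD y
    have hQ1 : H D y Q = 1 :=
      (mem_ae_iff_prob_eq_one hQm).1 (hH.ae_mem_quasicomponentIn hV hD hDV hyD hy)
    simp [measureReal_def, hQ1]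
  have hD𝓝 : D ∈ 𝓝 y := (hH.isOpen hD).mem_nhds hyD
  filter_upwards [hD𝓝, (hcont.continuousAt hD𝓝).eventually_ne hy1] with z hzD hz
  by_contra hzQ
  refine hz ?_
  rw [measureReal_def, measure_eq_zero_iff_ae_notMem.2
    (hH.ae_notMem_quasicomponentIn hV hD hDV hzD hzQ), ENNReal.toReal_zero]

theorem locallyConnectedSpace : LocallyConnectedSpace X := by
  refine locallyConnectedSpace_iff_subsets_isOpen_isConnected.2 fun x N hN => ?_
  obtain ⟨V, hV, hxV, hVN⟩ := hH.exists_closure_subset hN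
  have hQ := hH.isOpen_quasicomponentIn hV hxV
  exact ⟨quasicomponentIn V x,
    (quasicomponentIn_subset (hH.isOpen hV) hxV).trans (subset_closure.trans hVN), hQ,
    mem_quasicomponentIn, ⟨x, mem_quasicomponentIn⟩,
    isPreconnected_quasicomponentIn (hH.isOpen hV) hxV hQ⟩

theorem exists_isConnected_isCompact_closure (hV : V ∈ 𝓝 x) :
    ∃ B, IsOpen B ∧ IsConnected B ∧ x ∈ B ∧ IsCompact (closure B) ∧ closure B ⊆ V := by
  have := hH.locallyConnectedSpace
  obtain ⟨W, hW, hxW, hWV⟩ := hH.exists_closure_subset hV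
  obtain ⟨B, hBW, hB, hxB, hBc⟩ := locallyConnectedSpace_iff_subsets_isOpen_isConnected.1 this x W
    ((hH.isOpen hW).mem_nhds hxW)
  exact ⟨B, hB, hBc, hxB,
    (hH.relCompact W hW).of_isClosed_subset isClosed_closure (closure_mono hBW),
    (closure_mono hBW).trans hWV⟩

end IsNormalBauerFamily

end LocallyConnected

section Harmonic

variable {X : Type*} [TopologicalSpace X] [MeasurableSpace X] {𝒱 : Set (Set X)}
  {H : Set X → Kernel X X} {U U' : Set X} {h k : X → ℝ}

theorem IsHarmonicOn.mono (h_harm : IsHarmonicOn 𝒱 H U h) (hU : U' ⊆ U) :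
    IsHarmonicOn 𝒱 H U' h :=
  ⟨h_harm.1.mono hU, fun V hV hVU => h_harm.2 V hV (hVU.trans hU)⟩

theorem IsNormalBauerFamily.isHarmonicOn_congr (hH : IsNormalBauerFamily 𝒱 H)
    (h_harm : IsHarmonicOn 𝒱 H U h) (hk : EqOn k h U) : IsHarmonicOn 𝒱 H U k := by
  refine ⟨h_harm.1.congr hk, fun V hV hVU y hy => ?_⟩
  have hae : k =ᵐ[H V y] h :=
    (hH.ae_mem_frontier hV hy).mono fun z hz => hk (hVU (frontier_subset_closure hz))
  rw [integral_congr_ae hae, h_harm.2 V hV hVU y hy, hk (hVU (subset_closure hy))]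

end Harmonic

section StrongMinimumPrinciple

variable {X : Type*} [TopologicalSpace X] [T3Space X] [SecondCountableTopology X]
  [MeasurableSpace X] [BorelSpace X] {𝒱 : Set (Set X)}
  {H : Set X → Kernel X X} {D G : Set X} {z : X} {p : X → ℝ}

namespace IsNormalBauerFamily

variable (hH : IsNormalBauerFamily 𝒱 H)
include hH

/-- If `p` has lower limit `0` at `z`, then so has the harmonic function `H_D p ≤ p`, which by
ellipticity vanishes on the component of `z` in `D`. -/
theorem disjoint_posLiminfSet_frontier (hell : IsElliptic 𝒱 H) (hp : IsBddBorel p)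
    (hp0 : ∀ y, 0 ≤ p y) (hD : D ∈ 𝒱) (hle : ∀ y ∈ D, ∫ w, p w ∂(H D y) ≤ p y) (hzD : z ∈ D)
    (hz : z ∉ posLiminfSet p) :
    Disjoint (posLiminfSet p) (frontier (connectedComponentIn D z)) := by
  have := hH.locallyConnectedSpace
  have hDo := hH.isOpen hD
  set D' := connectedComponentIn D z
  have hDD' : D' ⊆ D := connectedComponentIn_subset D z
  have hzero : ∀ y ∈ D', ∫ w, p w ∂(H D y) = 0 := by
    refine (hell D' hDo.connectedComponentIn (isConnected_connectedComponentIn_iff.2 hzD) _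
      ((hH.isHarmonicOn_integral hD hp).mono hDD') fun y _ => integral_nonneg hp0).resolve_right
      fun hpos => hz ⟨(∫ w, p w ∂(H D z)) / 2, ?_, ?_⟩
    · exact half_pos (hpos z (mem_connectedComponentIn hzD))
    · filter_upwards [hDo.mem_nhds hzD,
        ((hH.continuousOn_integral hD hp).continuousAt (hDo.mem_nhds hzD)).eventually_const_lt
          (half_lt_self (hpos z (mem_connectedComponentIn hzD)))] with y hyD hy
      exact hy.le.trans (hle y hyD)
  refine disjoint_left.2 fun w ⟨δ, hδ, hw⟩ hwD' => ?_
  have hwD : w ∉ D :=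
    hH.notMem_of_mem_frontier hD (frontier_connectedComponentIn_subset hDo hwD')
  have hpos := hH.eventually_lt_integral hD hwD hp (hw.filter_mono nhdsWithin_le_nhds) hδ
  have hfreq : ∃ᶠ y in 𝓝 w, y ∈ D' :=
    mem_closure_iff_frequently.1 (frontier_subset_closure hwD')
  obtain ⟨y, hyD', hy⟩ := (hfreq.and_eventually (eventually_nhdsWithin_iff.1 hpos)).exists
  exact (hy (hDD' hyD')).ne' (hzero y hyD')

theorem strong_minimum_principle (hell : IsElliptic 𝒱 H) (hG : IsOpen G) (hGc : IsPreconnected G)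
    (hp : IsBddBorel p) (hp0 : ∀ y, 0 ≤ p y)
    (hle : ∀ D ∈ 𝒱, closure D ⊆ G → ∀ y ∈ D, ∫ w, p w ∂(H D y) ≤ p y)
    (hne : (G ∩ posLiminfSet p).Nonempty) : G ⊆ posLiminfSet p := by
  have := hH.locallyConnectedSpace
  obtain ⟨y₀, hy₀⟩ := hne
  set O := connectedComponentIn (G ∩ posLiminfSet p) y₀
  have hO : IsOpen O := (hG.inter (isOpen_posLiminfSet p)).connectedComponentIn
  have hOG : O ⊆ G ∩ posLiminfSet p := connectedComponentIn_subset _ _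
  have hy₀O : y₀ ∈ O := mem_connectedComponentIn hy₀
  suffices hclosed : closure O ∩ G ⊆ O from
    (hGc.subset_of_closure_inter_subset hO ⟨y₀, hy₀.1, hy₀O⟩ hclosed).trans
      (hOG.trans inter_subset_right)
  rintro z ⟨hzO, hzG⟩
  by_cases hz : z ∈ posLiminfSet p
  · exact closure_connectedComponentIn_inter_subset ⟨hzO, hzG, hz⟩
  exfalso
  have hzy₀ : z ≠ y₀ := fun h => hz (h ▸ hy₀.2)
  obtain ⟨D, hD, hzD, hDG⟩ :=
    hH.exists_closure_subset (inter_mem (hG.mem_nhds hzG) (isOpen_ne.mem_nhds hzy₀))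
  have hDG' := hDG.trans inter_subset_left
  have hdisj := hH.disjoint_posLiminfSet_frontier hell hp hp0 hD (hle D hD hDG') hzD hz
  have hD'o : IsOpen (connectedComponentIn D z) := (hH.isOpen hD).connectedComponentIn
  have hmeet : (O ∩ connectedComponentIn D z).Nonempty := by
    rw [inter_comm]
    exact mem_closure_iff.1 hzO _ hD'o (mem_connectedComponentIn hzD)
  obtain ⟨w, hwO, hw⟩ := inter_frontier_nonempty_of_isPreconnected
    isPreconnected_connectedComponentIn hD'o hmeet
    fun h => (hDG (subset_closure (connectedComponentIn_subset D z (h hy₀O)))).2 rfl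
  exact disjoint_left.1 hdisj (hOG hwO).2 hw

end IsNormalBauerFamily

end StrongMinimumPrinciple

section Balayage

variable {X : Type*} [TopologicalSpace X] [MeasurableSpace X] {𝒱 : Set (Set X)}
  {H : Set X → Kernel X X} {𝒲 : X → Set (Set X)} {U V V₀ D L : Set X} {C : ℝ} {g τ : X → ℝ}
  {e : ℕ → Set X}

theorem exists_seq_frequently_eq {α : Type*} {s : Set α} (hs : s.Countable) (hne : s.Nonempty) :
    ∃ e : ℕ → α, (∀ n, e n ∈ s) ∧ ∀ a ∈ s, ∃ᶠ n in atTop, e n = a := by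
  obtain ⟨f, rfl⟩ := hs.exists_eq_range hne
  refine ⟨fun n => f n.unpair.1, fun n => mem_range_self _, ?_⟩
  rintro _ ⟨k, rfl⟩
  refine frequently_atTop.2 fun N => ⟨Nat.pair k N, Nat.right_le_pair k N, ?_⟩
  simp only [Nat.unpair_pair]

theorem IsNormalBauerFamily.integral_le_of_closure_subset (hH : IsNormalBauerFamily 𝒱 H)
    (hg : IsBddHyperharmonicFor H (nbhdsIn 𝒱 U) U C g) (hD : D ∈ 𝒱) (hDU : closure D ⊆ U) (y : X) :
    ∫ z, g z ∂(H D y) ≤ g y := by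
  by_cases hy : y ∈ D
  · exact hg.integral_le y (hDU (subset_closure hy)) D ⟨hD, hDU, hy⟩
  · exact (hH.integral_of_notMem hD hy hg.measurable).le

/-- The iterated integrals `H_{e (n-1)} ⋯ H_{e 0} g`, which sweep `g` out of the sets `e i`. -/
noncomputable def sweep (H : Set X → Kernel X X) (e : ℕ → Set X) (g : X → ℝ) : ℕ → X → ℝ
  | 0 => g
  | n + 1 => fun y => ∫ z, sweep H e g n z ∂(H (e n) y)

/-- The limit of the decreasing sequence `sweep H e g`. -/
noncomputable def sweepLim (H : Set X → Kernel X X) (e : ℕ → Set X) (g : X → ℝ) (y : X) : ℝ :=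
  ⨅ n, sweep H e g n y

/-- `τ` is obtained from a function `g` with values in `[0, C]` by sweeping it out of `V₀ \ L`: it
is hyperharmonic on `V₀`, equal to `g` on `L` and harmonic on `V₀ \ L`. -/
structure IsBalayage (𝒱 : Set (Set X)) (H : Set X → Kernel X X) (V₀ L : Set X) (C : ℝ)
    (g τ : X → ℝ) : Prop where
  measurable : Measurable τ
  mem_Icc : ∀ y, τ y ∈ Icc 0 C
  integral_le : ∀ D ∈ 𝒱, closure D ⊆ V₀ → ∀ y, ∫ z, τ z ∂(H D y) ≤ τ y
  eqOn : EqOn τ g L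
  isHarmonicOn : IsHarmonicOn 𝒱 H (V₀ \ L) τ

variable [T3Space X] [SecondCountableTopology X] [BorelSpace X]

namespace IsNormalBauerFamily

variable (hH : IsNormalBauerFamily 𝒱 H)
include hH

theorem lowerSemicontinuousOn_integral (hV : V ∈ 𝒱) (hU : IsOpen U) (hg : IsBddBorel g)
    (hlsc : LowerSemicontinuousOn g U) :
    LowerSemicontinuousOn (fun y => ∫ z, g z ∂(H V y)) U := by
  intro y hy t (ht : t < ∫ z, g z ∂(H V y))
  rw [hU.nhdsWithin_eq hy]
  by_cases hyV : y ∈ V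
  · exact ((hH.continuousOn_integral hV hg).continuousAt
      ((hH.isOpen hV).mem_nhds hyV)).eventually_const_lt ht
  rw [hH.integral_of_notMem hV hyV hg.1] at ht
  obtain ⟨s, hts, hsg⟩ := exists_between ht
  have hs : ∀ᶠ z in 𝓝 y, s < g z := hU.nhdsWithin_eq hy ▸ hlsc y hy s hsg
  filter_upwards [hs, eventually_nhdsWithin_iff.1 (hH.eventually_lt_integral hV hyV hg
    ((hs.filter_mono nhdsWithin_le_nhds).mono fun _ => le_of_lt) hts)] with z hz hzV
  by_cases h : z ∈ V
  · exact hzV h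
  · rw [hH.integral_of_notMem hV h hg.1]
    exact hts.trans hz

theorem isBddHyperharmonicFor_integral (hV₀ : V₀ ∈ 𝒱)
    (hg : IsBddHyperharmonicFor H (nbhdsIn 𝒱 V₀) V₀ C g) (hV : V ∈ 𝒱) (hVV₀ : closure V ⊆ V₀) :
    IsBddHyperharmonicFor H (nbhdsIn 𝒱 V₀) V₀ C fun y => ∫ z, g z ∂(H V y) := by
  classical
  let N : X → Set X := fun y => if y ∈ V then V else V₀
  have hN : ∀ y ∈ V₀, N y ∈ 𝓝 y := fun y hy => by
    by_cases hyV : y ∈ V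
    · simpa only [N, if_pos hyV] using (hH.isOpen hV).mem_nhds hyV
    · simpa only [N, if_neg hyV] using (hH.isOpen hV₀).mem_nhds hy
  have hNV₀ : ∀ y ∈ V₀, N y ⊆ V₀ := fun y _ => by
    simp only [N]
    split_ifs
    exacts [subset_closure.trans hVV₀, subset_rfl]
  refine hH.isBddHyperharmonicFor_nbhdsIn
    ((hH.isSeparatingChoice_nbhdsIn hV₀).refine subset_rfl hN hNV₀)
    ⟨(hH.isBddBorel_integral hV hg.isBddBorel).1, fun y => ?_,
      hH.lowerSemicontinuousOn_integral hV (hH.isOpen hV₀) hg.isBddBorel hg.lsc, ?_⟩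
  · have := hH.isProbabilityMeasure hV y
    exact integral_mem_Icc hg.measurable hg.mem_Icc
  rintro y hy W ⟨⟨hW, hWV₀, hyW⟩, hWN⟩
  by_cases hyV : y ∈ V
  · simp only [N, if_pos hyV] at hWN
    exact (hH.integral_integral hV hW (subset_closure.trans hWN) hg.isBddBorel y).le
  · calc ∫ z, ∫ w, g w ∂(H V z) ∂(H W y)
        ≤ ∫ z, g z ∂(H W y) :=
          hH.integral_mono hW hyW (hH.isBddBorel_integral hV hg.isBddBorel) hg.isBddBorel
            fun z _ => hH.integral_le_of_closure_subset hg hV hVV₀ z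
      _ ≤ g y := hg.integral_le y hy W ⟨hW, hWV₀, hyW⟩
      _ = ∫ z, g z ∂(H V y) := (hH.integral_of_notMem hV hyV hg.measurable).symm

theorem isHarmonicOn_of_isSeparatingChoice (h𝒲 : IsSeparatingChoice 𝒱 H U 𝒲) (hτ : Measurable τ)
    (hτC : ∀ y, τ y ∈ Icc 0 C) (hcont : ContinuousOn τ U)
    (heq : ∀ y ∈ U, ∀ W ∈ 𝒲 y, ∫ z, τ z ∂(H W y) = τ y) : IsHarmonicOn 𝒱 H U τ := by
  refine ⟨hcont, fun D hD hDU y hy => le_antisymm ?_ ?_⟩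
  · exact hH.integral_le_of_isSeparatingChoice h𝒲 ⟨hτ, hτC, hcont.lowerSemicontinuousOn,
      fun y hy W hW => (heq y hy W hW).le⟩ hD hDU hy
  have hτb : IsBddBorel τ := .of_mem_Icc hτ hτC
  have integral_const_sub : ∀ W ∈ 𝒱, ∀ y, ∫ z, (C - τ z) ∂(H W y) = C - ∫ z, τ z ∂(H W y) :=
    fun W hW y => by rw [hH.integral_sub hW (.const C) hτb, hH.integral_const hW]
  have hle := hH.integral_le_of_isSeparatingChoice h𝒲 (g := fun z => C - τ z) (C := C)
    ⟨measurable_const.sub hτ, fun z => ⟨sub_nonneg.2 (hτC z).2, sub_le_self C (hτC z).1⟩,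
      (continuousOn_const.sub hcont).lowerSemicontinuousOn, fun y hy W hW => ?_⟩ hD hDU hy
  · rw [integral_const_sub D hD] at hle
    linarith
  · rw [integral_const_sub W ((h𝒲.localChoice y hy).1 hW).1, heq y hy W hW]

theorem isHarmonicOn_of_forall_exists (hV₀ : V₀ ∈ 𝒱) (hUV₀ : U ⊆ V₀) (hτ : Measurable τ)
    (hτC : ∀ y, τ y ∈ Icc 0 C)
    (hloc : ∀ y ∈ U, ∃ V ∈ 𝒱, y ∈ V ∧ V ⊆ U ∧ ∀ z, ∫ w, τ w ∂(H V z) = τ z) :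
    IsHarmonicOn 𝒱 H U τ := by
  have hτb : IsBddBorel τ := .of_mem_Icc hτ hτC
  choose! V hV hyV hVU hVτ using hloc
  have hV𝓝 : ∀ y ∈ U, V y ∈ 𝓝 y := fun y hy => (hH.isOpen (hV y hy)).mem_nhds (hyV y hy)
  have h𝒲 := (hH.isSeparatingChoice_nbhdsIn hV₀).refine hUV₀ hV𝓝 hVU
  refine hH.isHarmonicOn_of_isSeparatingChoice h𝒲 hτ hτC (fun y hy => ?_) ?_
  · have hcont := (hH.continuousOn_integral (hV y hy) hτb).continuousAt (hV𝓝 y hy)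
    simp only [hVτ y hy] at hcont
    exact hcont.continuousWithinAt
  · rintro y hy W ⟨⟨hW, -, -⟩, hWV⟩
    simpa only [hVτ y hy] using
      hH.integral_integral (hV y hy) hW (subset_closure.trans hWV) hτb y

section Sweep

variable (hV₀ : V₀ ∈ 𝒱) (hg : IsBddHyperharmonicFor H (nbhdsIn 𝒱 V₀) V₀ C g)
  (he : ∀ n, e n ∈ 𝒱) (heV₀ : ∀ n, closure (e n) ⊆ V₀)
include hV₀ hg he heV₀

theorem isBddHyperharmonicFor_sweep (n : ℕ) :
    IsBddHyperharmonicFor H (nbhdsIn 𝒱 V₀) V₀ C (sweep H e g n) := by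
  induction n with
  | zero => exact hg
  | succ n ih => exact hH.isBddHyperharmonicFor_integral hV₀ ih (he n) (heV₀ n)

theorem sweep_of_notMem {y : X} (hy : ∀ n, y ∉ e n) (n : ℕ) : sweep H e g n y = g y := by
  induction n with
  | zero => rfl
  | succ n ih =>
    exact (hH.integral_of_notMem (he n) (hy n)
      (hH.isBddHyperharmonicFor_sweep hV₀ hg he heV₀ n).measurable).trans ih

theorem tendsto_sweep (y : X) :
    Tendsto (fun n => sweep H e g n y) atTop (𝓝 (sweepLim H e g y)) := by
  have hsweep := hH.isBddHyperharmonicFor_sweep hV₀ hg he heV₀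
  refine tendsto_atTop_ciInf (antitone_nat_of_succ_le fun n =>
    hH.integral_le_of_closure_subset (hsweep n) (he n) (heV₀ n) y) ⟨0, ?_⟩
  rintro _ ⟨n, rfl⟩
  exact ((hsweep n).mem_Icc y).1

theorem measurable_sweepLim : Measurable (sweepLim H e g) :=
  measurable_of_tendsto_metrizable
    (fun n => (hH.isBddHyperharmonicFor_sweep hV₀ hg he heV₀ n).measurable)
    (tendsto_pi_nhds.2 (hH.tendsto_sweep hV₀ hg he heV₀))

theorem sweepLim_mem_Icc (y : X) : sweepLim H e g y ∈ Icc 0 C :=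
  isClosed_Icc.mem_of_tendsto (hH.tendsto_sweep hV₀ hg he heV₀ y)
    (.of_forall fun n => (hH.isBddHyperharmonicFor_sweep hV₀ hg he heV₀ n).mem_Icc y)

theorem tendsto_integral_sweep (hD : D ∈ 𝒱) (y : X) :
    Tendsto (fun n => ∫ z, sweep H e g n z ∂(H D y)) atTop
      (𝓝 (∫ z, sweepLim H e g z ∂(H D y))) := by
  have := hH.isProbabilityMeasure hD y
  have hsweep := hH.isBddHyperharmonicFor_sweep hV₀ hg he heV₀
  refine tendsto_integral_of_dominated_convergence (fun _ => C)
    (fun n => (hsweep n).measurable.aestronglyMeasurable) (integrable_const C)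
    (fun n => .of_forall fun z => ?_) (.of_forall (hH.tendsto_sweep hV₀ hg he heV₀))
  exact (Real.norm_of_nonneg ((hsweep n).mem_Icc z).1).trans_le ((hsweep n).mem_Icc z).2

theorem integral_sweepLim_le (hD : D ∈ 𝒱) (hDV₀ : closure D ⊆ V₀) (y : X) :
    ∫ z, sweepLim H e g z ∂(H D y) ≤ sweepLim H e g y :=
  le_of_tendsto_of_tendsto' (hH.tendsto_integral_sweep hV₀ hg he heV₀ hD y)
    (hH.tendsto_sweep hV₀ hg he heV₀ y) fun n => hH.integral_le_of_closure_subset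
      (hH.isBddHyperharmonicFor_sweep hV₀ hg he heV₀ n) hD hDV₀ y

theorem integral_sweepLim_eq (hV : V ∈ 𝒱) (heV : ∃ᶠ n in atTop, e n = V) (y : X) :
    ∫ z, sweepLim H e g z ∂(H V y) = sweepLim H e g y := by
  refine tendsto_nhds_unique_of_frequently_eq (hH.tendsto_integral_sweep hV₀ hg he heV₀ hV y)
    ((hH.tendsto_sweep hV₀ hg he heV₀ y).comp (tendsto_add_atTop_nat 1)) (heV.mono ?_)
  rintro n rfl
  rfl

end Sweep

theorem exists_isBalayage (hV₀ : V₀ ∈ 𝒱)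
    (hg : IsBddHyperharmonicFor H (nbhdsIn 𝒱 V₀) V₀ C g) (hL : IsClosed L) :
    ∃ τ, IsBalayage 𝒱 H V₀ L C g τ := by
  have hU : IsOpen (V₀ \ L) := (hH.isOpen hV₀).sdiff hL
  obtain ⟨𝒞, h𝒞𝒱, h𝒞, h𝒞b⟩ := hH.isBasis.exists_countable
  have hcover : ∀ y ∈ V₀ \ L, ∃ V ∈ {V ∈ 𝒞 | closure V ⊆ V₀ \ L}, y ∈ V := fun y hy => by
    obtain ⟨N, hN, hNc, hNU⟩ := exists_mem_nhds_isClosed_subset (hU.mem_nhds hy)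
    obtain ⟨V, hV, hyV, hVN⟩ := h𝒞b.mem_nhds_iff.1 hN
    exact ⟨V, ⟨hV, (closure_minimal hVN hNc).trans hNU⟩, hyV⟩
  rcases (V₀ \ L).eq_empty_or_nonempty with hempty | ⟨y₀, hy₀⟩
  · refine ⟨g, hg.measurable, hg.mem_Icc, fun D hD hDV₀ =>
      hH.integral_le_of_closure_subset hg hD hDV₀, eqOn_refl g L,
      hH.isHarmonicOn_of_forall_exists hV₀ sdiff_subset hg.measurable hg.mem_Icc (by simp [hempty])⟩
  obtain ⟨V₁, hV₁, -⟩ := hcover y₀ hy₀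
  obtain ⟨e, he𝒞, hefreq⟩ := exists_seq_frequently_eq (h𝒞.mono (sep_subset 𝒞 _)) ⟨V₁, hV₁⟩
  have he : ∀ n, e n ∈ 𝒱 := fun n => h𝒞𝒱 (he𝒞 n).1
  have heV₀ : ∀ n, closure (e n) ⊆ V₀ := fun n => (he𝒞 n).2.trans sdiff_subset
  have hmeas := hH.measurable_sweepLim hV₀ hg he heV₀
  have hmem := hH.sweepLim_mem_Icc hV₀ hg he heV₀
  refine ⟨sweepLim H e g, hmeas, hmem, fun D hD => hH.integral_sweepLim_le hV₀ hg he heV₀ hD,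
    fun y hy => ?_, hH.isHarmonicOn_of_forall_exists hV₀ sdiff_subset hmeas hmem fun y hy => ?_⟩
  · have hye : ∀ n, y ∉ e n := fun n hyn => ((he𝒞 n).2 (subset_closure hyn)).2 hy
    simp only [sweepLim, hH.sweep_of_notMem hV₀ hg he heV₀ hye, ciInf_const]
  · obtain ⟨V, hV, hyV⟩ := hcover y hy
    exact ⟨V, h𝒞𝒱 hV.1, hyV, subset_closure.trans hV.2,
      hH.integral_sweepLim_eq hV₀ hg he heV₀ (h𝒞𝒱 hV.1) (hefreq V hV)⟩

end IsNormalBauerFamily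

end Balayage

section Potentials

variable {X : Type*} [TopologicalSpace X] [MeasurableSpace X] {𝒱 : Set (Set X)}
  {H : Set X → Kernel X X} {𝒲 : X → Set (Set X)} {U V₀ W B L : Set X} {C c a : ℝ}
  {g τ p : X → ℝ} {z : X}

/-- The difference between `τ` and `H_W τ`, which is the potential part of the Riesz decomposition
on `W` of a bounded hyperharmonic function `τ`. -/
noncomputable def potentialPart (H : Set X → Kernel X X) (W : Set X) (τ : X → ℝ) (y : X) : ℝ :=
  τ y - ∫ z, τ z ∂(H W y)

/-- `p` is a bounded potential on `W` which is harmonic on `W \ L` and tends to zero at `∂W`. -/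
structure IsPotentialOff (𝒱 : Set (Set X)) (H : Set X → Kernel X X) (W L : Set X)
    (p : X → ℝ) : Prop where
  isBddBorel : IsBddBorel p
  nonneg : ∀ y, 0 ≤ p y
  integral_le : ∀ D ∈ 𝒱, closure D ⊆ W → ∀ y ∈ D, ∫ z, p z ∂(H D y) ≤ p y
  isHarmonicOn : IsHarmonicOn 𝒱 H (W \ L) p
  tendsto_zero : ∀ z ∈ frontier W, Tendsto p (𝓝[W] z) (𝓝 0)

namespace IsPotentialOff

variable (hp : IsPotentialOff 𝒱 H W L p) (hW : IsOpen W) (hL : IsClosed L)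
  (hpL : ∀ᶠ z in 𝓝ˢ L, a ≤ p z)
include hp hW hL

theorem continuousAt (hz : z ∈ W \ L) : ContinuousAt p z :=
  hp.isHarmonicOn.1.continuousAt ((hW.sdiff hL).mem_nhds hz)

include hpL

theorem isClosed_superlevel (ha : 0 < a) : IsClosed {y ∈ W | a ≤ p y} := by
  refine isClosed_of_eventually_notMem (sep_subset W _) fun z hz hza => ?_
  suffices hlt : ∀ᶠ y in 𝓝[W] z, p y < a from hlt.mono fun y hy hya => hy.not_ge hya.2
  by_cases hzW : z ∈ W
  · have hpz : p z < a := not_le.1 fun h => hza ⟨hzW, h⟩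
    have hzL : z ∉ L := fun h => hpz.not_ge (hpL.self_of_nhdsSet z h)
    exact ((hp.continuousAt hW hL ⟨hzW, hzL⟩).eventually_lt_const hpz).filter_mono
      nhdsWithin_le_nhds
  · exact (hp.tendsto_zero z (hW.frontier_eq ▸ ⟨hz, hzW⟩)).eventually_lt_const ha

theorem mem_sdiff_of_mem_frontier_superlevel (ha : 0 < a)
    (hz : z ∈ frontier {y ∈ W | a ≤ p y}) : z ∈ W \ L ∧ p z = a := by
  have hzK := (hp.isClosed_superlevel hW hL hpL ha).frontier_subset hz
  have not_eventually : ¬ ∀ᶠ y in 𝓝 z, a ≤ p y := fun h =>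
    hz.2 (mem_interior_iff_mem_nhds.2 ((hW.eventually_mem hzK.1).and h))
  have hzL : z ∉ L := fun h => not_eventually (eventually_nhdsSet_iff_forall.1 hpL z h)
  refine ⟨⟨hzK.1, hzL⟩, hzK.2.antisymm' (not_lt.1 fun hlt => not_eventually ?_)⟩
  exact ((hp.continuousAt hW hL ⟨hzK.1, hzL⟩).eventually_const_lt hlt).mono fun _ => le_of_lt

end IsPotentialOff

theorem IsBddHyperharmonicFor.min_const (hH : IsNormalBauerFamily 𝒱 H)
    (hg : IsBddHyperharmonicFor H 𝒲 U C g) (h𝒲 : ∀ y ∈ U, 𝒲 y ⊆ 𝒱) (hc : 0 ≤ c) :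
    IsBddHyperharmonicFor H 𝒲 U C fun y => min (g y) c := by
  have hm : Measurable fun y => min (g y) c := hg.measurable.min measurable_const
  have hmC : ∀ y, min (g y) c ∈ Icc 0 C := fun y =>
    ⟨le_min (hg.mem_Icc y).1 hc, (min_le_left _ _).trans (hg.mem_Icc y).2⟩
  refine ⟨hm, hmC, hg.lsc.inf lowerSemicontinuousOn_const, fun y hy W hW => le_min ?_ ?_⟩
  · exact (integral_mono (hH.integrable (h𝒲 y hy hW) (.of_mem_Icc hm hmC) y)
      (hH.integrable (h𝒲 y hy hW) hg.isBddBorel y) fun _ => min_le_left _ _).trans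
      (hg.integral_le y hy W hW)
  · exact (integral_mono (hH.integrable (h𝒲 y hy hW) (.of_mem_Icc hm hmC) y)
      (hH.integrable (h𝒲 y hy hW) (.const c) y) fun _ => min_le_right _ _).trans_eq
      (hH.integral_const (h𝒲 y hy hW) c y)

theorem IsNormalBauerFamily.inter_posLiminfSet_potentialPart_nonempty
    (hH : IsNormalBauerFamily 𝒱 H) (hg : IsBddHyperharmonicFor H 𝒲 V₀ C g)
    (hW : W ∈ 𝒱) (hWV₀ : W ⊆ V₀) (hB : IsOpen B) (hBW : B ⊆ W) (hτ : IsBddBorel τ)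
    (hτg : EqOn τ g B) (hp : ∀ y, 0 ≤ potentialPart H W τ y) (hgB : ¬ IsHarmonicOn 𝒱 H B g) :
    (B ∩ posLiminfSet (potentialPart H W τ)).Nonempty := by
  obtain ⟨y, hy, hpy⟩ : ∃ y ∈ B, 0 < potentialPart H W τ y := by
    by_contra! hnonpos
    refine hgB (hH.isHarmonicOn_congr ((hH.isHarmonicOn_integral hW hτ).mono hBW)
      fun y hy => ?_)
    rw [← hτg hy]
    exact sub_eq_zero.1 ((hnonpos y hy).antisymm (hp y))
  have hlsc : LowerSemicontinuousOn (potentialPart H W τ) B :=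
    LowerSemicontinuousOn.add
      (fun z hz => LowerSemicontinuousWithinAt.congr_of_eventuallyEq
        (hg.lsc.mono (hBW.trans hWV₀) z hz) hz hτg.symm.eventuallyEq_nhdsWithin)
      ((hH.continuousOn_integral hW hτ).mono hBW).neg.lowerSemicontinuousOn
  refine ⟨y, hy, potentialPart H W τ y / 2, half_pos hpy, ?_⟩
  exact (hB.nhdsWithin_eq hy ▸ hlsc y hy _ (half_lt_self hpy)).mono fun _ => le_of_lt

variable [T3Space X] [SecondCountableTopology X] [BorelSpace X]

namespace IsNormalBauerFamily

variable (hH : IsNormalBauerFamily 𝒱 H)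
include hH

/-- If `g y < g z` with `y, z ∈ B`, then ellipticity prevents `g z - min g (g z)` from being
harmonic on `B`, since it is positive at `y` and zero at `z`. -/
theorem exists_not_isHarmonicOn (hell : IsElliptic 𝒱 H) (hV₀ : V₀ ∈ 𝒱) (hB : IsOpen B)
    (hBc : IsConnected B) (hBV₀ : B ⊆ V₀) :
    ∃ C g, IsBddHyperharmonicFor H (nbhdsIn 𝒱 V₀) V₀ C g ∧ ¬ IsHarmonicOn 𝒱 H B g := by
  obtain ⟨x, hx⟩ := hBc.nonempty
  obtain ⟨D, hD, hxD, hDB⟩ := hH.exists_closure_subset (hB.mem_nhds hx)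
  obtain ⟨b, hbD⟩ := hH.frontier_nonempty hD hxD
  have hb : b ∈ B := hDB (frontier_subset_closure hbD)
  have hxb : x ≠ b := fun h => hH.notMem_of_mem_frontier hD hbD (h ▸ hxD)
  obtain ⟨C, g, hg, hne⟩ :=
    (hH.isSeparatingChoice_nbhdsIn hV₀).separate x (hBV₀ hx) b (hBV₀ hb) hxb
  obtain ⟨y, hy, z, hz, hyz⟩ : ∃ y ∈ B, ∃ z ∈ B, g y < g z :=
    hne.lt_or_gt.elim (fun h => ⟨x, hx, b, hb, h⟩) fun h => ⟨b, hb, x, hx, h⟩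
  have hmin := hg.min_const hH (fun _ _ _ hW => hW.1) (hg.mem_Icc z).1
  refine ⟨C, _, hmin, fun hharm => ?_⟩
  have hdiff : IsHarmonicOn 𝒱 H B fun w => g z - min (g w) (g z) := by
    refine ⟨continuousOn_const.sub hharm.1, fun V hV hVB w hw => ?_⟩
    rw [hH.integral_sub hV (.const _) hmin.isBddBorel, hH.integral_const hV,
      hharm.2 V hV hVB w hw]
  rcases hell B hB hBc _ hdiff fun w _ => sub_nonneg.2 (min_le_right _ _) with hzero | hpos
  · have := hzero y hy
    rw [min_eq_left hyz.le] at this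
    linarith
  · have := hpos z hz
    rw [min_self, sub_self] at this
    exact this.false

theorem isPotentialOff_potentialPart (hτ : IsBalayage 𝒱 H V₀ L C g τ) (hV₀ : V₀ ∈ 𝒱) (hW : W ∈ 𝒱)
    (hWV₀ : closure W ⊆ V₀) (hL : IsClosed L) (hLW : L ⊆ W) :
    IsPotentialOff 𝒱 H W L (potentialPart H W τ) := by
  have hτb : IsBddBorel τ := .of_mem_Icc hτ.measurable hτ.mem_Icc
  have hkb := hH.isBddBorel_integral hW hτb
  have hWL : W \ L ⊆ V₀ \ L := sdiff_subset_sdiff_left (subset_closure.trans hWV₀)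
  have integral_eq : ∀ D ∈ 𝒱, D ⊆ W → ∀ y, ∫ z, potentialPart H W τ z ∂(H D y) =
      ∫ z, τ z ∂(H D y) - ∫ z, τ z ∂(H W y) := fun D hD hDW y => by
    simp only [potentialPart]
    rw [hH.integral_sub hD hτb hkb, hH.integral_integral hW hD hDW hτb]
  refine ⟨hτb.sub hkb, fun y => sub_nonneg.2 (hτ.integral_le W hW hWV₀ y), ?_, ?_, ?_⟩
  · intro D hD hDW y _
    rw [integral_eq D hD (subset_closure.trans hDW)]
    exact sub_le_sub_right (hτ.integral_le D hD
      (hDW.trans (subset_closure.trans hWV₀)) y) _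
  · refine ⟨(hτ.isHarmonicOn.1.mono hWL).sub
      ((hH.continuousOn_integral hW hτb).mono sdiff_subset), fun D hD hDU y hy => ?_⟩
    rw [integral_eq D hD (subset_closure.trans (hDU.trans sdiff_subset)),
      hτ.isHarmonicOn.2 D hD (hDU.trans hWL) y hy, potentialPart]
  · intro z hz
    have hzW := hH.notMem_of_mem_frontier hW hz
    have hcont : ContinuousAt τ z := hτ.isHarmonicOn.1.continuousAt
      (((hH.isOpen hV₀).sdiff hL).mem_nhds ⟨hWV₀ (frontier_subset_closure hz),
        fun h => hzW (hLW h)⟩)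
    have hlim := (hcont.tendsto.mono_left nhdsWithin_le_nhds).sub
      (hH.tendsto_integral hW hzW hτb hcont.continuousWithinAt)
    rw [sub_self] at hlim
    exact hlim

theorem isStronglyStable_superlevel (hp : IsPotentialOff 𝒱 H W L p) (hW : W ∈ 𝒱)
    (hL : IsClosed L) (hLne : L.Nonempty) (hLW : L ⊆ W) (ha : 0 < a)
    (hpL : ∀ᶠ z in 𝓝ˢ L, a ≤ p z) : IsStronglyStable 𝒱 H {y ∈ W | a ≤ p y} := by
  have hWo := hH.isOpen hW
  have hLK : L ⊆ {y ∈ W | a ≤ p y} := fun y hy => ⟨hLW hy, hpL.self_of_nhdsSet y hy⟩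
  have hKL : W \ {y ∈ W | a ≤ p y} ⊆ W \ L := sdiff_subset_sdiff_right hLK
  refine ⟨hLne.mono hLK, (hH.relCompact W hW).of_isClosed_subset
    (hp.isClosed_superlevel hWo hL hpL ha) ((sep_subset W _).trans subset_closure), W,
    hH.isPSet hW, sep_subset W _, fun y => a - p y,
    ⟨continuousOn_const.sub (hp.isHarmonicOn.1.mono hKL), fun V hV hVK y hy => ?_⟩,
    fun y hy => sub_pos.2 (not_le.1 fun h => hy.2 ⟨hy.1, h⟩), fun z hz => ?_⟩
  · rw [hH.integral_sub hV (.const a) hp.isBddBorel, hH.integral_const hV,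
      hp.isHarmonicOn.2 V hV (hVK.trans hKL) y hy]
  · obtain ⟨hzWL, hpz⟩ := hp.mem_sdiff_of_mem_frontier_superlevel hWo hL hpL ha hz
    have hlim : Tendsto (fun y => a - p y) (𝓝 z) (𝓝 (a - p z)) :=
      tendsto_const_nhds.sub (hp.continuousAt hWo hL hzWL)
    rw [hpz, sub_self] at hlim
    exact hlim.mono_left nhdsWithin_le_nhds

theorem exists_isPotentialOff (hell : IsElliptic 𝒱 H) {x : X} {V : Set X} (hV : V ∈ 𝓝 x) :
    ∃ W ∈ 𝒱, W ⊆ V ∧ ∃ L ⊆ W, IsClosed L ∧ x ∈ L ∧ ∃ p, IsPotentialOff 𝒱 H W L p ∧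
      ∃ a > 0, ∀ᶠ z in 𝓝ˢ L, a ≤ p z := by
  obtain ⟨V₀, hV₀, hxV₀, hV₀V⟩ := hH.exists_closure_subset hV
  obtain ⟨W, hW, hxW, hWV₀⟩ := hH.exists_closure_subset ((hH.isOpen hV₀).mem_nhds hxV₀)
  obtain ⟨G, hG, hGc, hxG, -, hGW⟩ :=
    hH.exists_isConnected_isCompact_closure ((hH.isOpen hW).mem_nhds hxW)
  obtain ⟨B, hB, hBc, hxB, hBcomp, hBG⟩ :=
    hH.exists_isConnected_isCompact_closure (hG.mem_nhds hxG)
  have hGW' : G ⊆ W := subset_closure.trans hGW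
  have hWV₀' : W ⊆ V₀ := subset_closure.trans hWV₀
  have hBW : B ⊆ W := subset_closure.trans (hBG.trans hGW')
  obtain ⟨C, g, hg, hgB⟩ := hH.exists_not_isHarmonicOn hell hV₀ hB hBc (hBW.trans hWV₀')
  obtain ⟨τ, hτ⟩ := hH.exists_isBalayage hV₀ hg (isClosed_closure (s := B))
  have hp := hH.isPotentialOff_potentialPart hτ hV₀ hW hWV₀ isClosed_closure (hBG.trans hGW')
  have hne := hH.inter_posLiminfSet_potentialPart_nonempty hg hW hWV₀' hB hBW
    (.of_mem_Icc hτ.measurable hτ.mem_Icc) (hτ.eqOn.mono subset_closure) hp.nonneg hgB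
  have hpos := hH.strong_minimum_principle hell hG hGc.isPreconnected hp.isBddBorel hp.nonneg
    (fun D hD hDG => hp.integral_le D hD (hDG.trans hGW'))
    (hne.mono (inter_subset_inter_left _ (subset_closure.trans hBG)))
  exact ⟨W, hW, hWV₀'.trans (subset_closure.trans hV₀V), closure B, hBG.trans hGW',
    isClosed_closure, subset_closure hxB, _, hp,
    exists_pos_eventually_nhdsSet_le hBcomp (hBG.trans hpos)⟩

end IsNormalBauerFamily

end Potentials

end BauerSpace

theorem lemma5p1 {X : Type*} [TopologicalSpace X] [T2Space X] [LocallyCompactSpace X]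
    [SecondCountableTopology X] [MeasurableSpace X] [BorelSpace X]
    (𝒱 : Set (Set X)) (H : Set X → Kernel X X)
    (hH : BauerSpace.IsNormalBauerFamily 𝒱 H) (hell : BauerSpace.IsElliptic 𝒱 H)
    (x : X) (V : Set X) (hV : IsOpen V) (hxV : x ∈ V) :
    ∃ K : Set X, BauerSpace.IsStronglyStable 𝒱 H K ∧ K ∈ 𝓝 x ∧ K ⊆ V := by
  obtain ⟨W, hW, hWV, L, hLW, hL, hxL, p, hp, a, ha, hpL⟩ :=
    hH.exists_isPotentialOff hell (hV.mem_nhds hxV)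
  have hK : {y ∈ W | a ≤ p y} ∈ 𝓝 x := ((hH.isOpen hW).eventually_mem (hLW hxL)).and
    (eventually_nhdsSet_iff_forall.1 hpL x hxL)
  exact ⟨{y ∈ W | a ≤ p y}, hH.isStronglyStable_superlevel hp hW hL ⟨x, hxL⟩ hLW ha hpL, hK,
    (sep_subset W _).trans hWV⟩
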